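/- Let $\mathfrak X$ be a complex manifold with complex structure $J$, equipped with a smooth Hermitian metric $g$ (a Riemannian metric for which $J$ is an isometry). Let $M\subset\mathfrak X$ be an embedded CR submanifold of type $(n,k)$, i.e. a smooth embedded real submanifold of real dimension $2n+k$ such that $H_xM=T_xM\cap JT_xM$ has real dimension $2n$ for all $x\in M$. Write $v^{NM}$ for the $g$-orthogonal projection of $v\in T_x\mathfrak X$ onto $N_xM=(T_xM)^\perp$. (1) For $x\in M$ and $X\in H_xM$, extend $X$ to a smooth vector field $\tilde X$ on a neighbourhood of $x$ in $\mathfrak X$ with values in $HM$ along $M$. Such extensions exist, and $$L^{NM}_x(X)=(J[J\tilde X,\tilde X])^{NM}_x$$ does not depend on the choice (normal-valued Levi form). Similarly, for any connection $\nabla$ on the tangent bundle of a Riemannian manifold, any embedded submanifold $S$ and $u,v\in T_xS$, the second fundamental form $B_x(u,v)=(\nabla_uY)^{NS}$ does not depend on the choice of the smooth local vector field $Y$ that extends $v$ and is tangent to $S$ along $S$, and such $Y$ exist. (2) Let $B$ be the second fundamental form of $M$ with respect to the Hermitian (Chern) connection of $g$, that is, the connection with $\nabla g=0$, $\nabla J=0$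 and $\nabla_{Ju}Y=J\nabla_uY$ for all local holomorphic vector fields $Y$; or, if $g$ is Kähler, with respect to the Levi-Civita connection. Then for all $x\in M$ and $X\in H_xM$ $$L^{NM}_x(X)=B_x(X,X)+B_x(JX,JX).$$ (3) Let $\mathfrak X=\mathbb C^m$ with the Euclidean metric, $x\in M$, $X\in H_xM$ with $|X|=1$, and $\ell=\operatorname{span}_{\mathbb R}\{X,JX\}$. Near $x$ the slice $\Sigma=M\cap(x+\ell+N_xM)$ is an embedded surface with $T_x\Sigma=\ell$, and $$L^{NM}_x(X)=2\,(\vec H_\Sigma(x))^{NM},$$ where $\vec H_\Sigma=\tfrac12\operatorname{tr}B_\Sigma$ is the mean curvature vector of $\Sigma$ in $\mathbb C^m$. More generally, let $\Sigma\subset M$ be an embedded surface through $x$ such that $T_x\Sigma=\ell$, or such that for every $v\in\ell$ it contains, near $x$, the geodesic of $M$ starting at $x$ with velocity $v$. Then $T_x\Sigma=\ell$ and $$L^{NM}_x(X)=\big(B_\Sigma(X,X)+B_\Sigma(JX,JX)\big)^{NM}=2\,(\vec H_\Sigma(x))^{NM}.$$ (4) Let $\Gamma\subset\mathbb R^{n+k}$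 be an embedded submanifold of dimension $n$ and let $M=\Gamma\times i\mathbb R^{n+k}\subset\mathbb C^{n+k}$, with Euclidean metrics. Then $M$ is a CR submanifold of type $(n,k)$, and for $z\in M$, $p=\operatorname{Re}z$, one has $H_zM=T_p\Gamma\oplus iT_p\Gamma$. For $X\in T_p\Gamma$, regarded as a real vector in $\mathbb C^{n+k}$, $$L^{NM}_z(X)=B_z(X,X)=B^\Gamma_p(X,X),$$ where $B$ and $B^\Gamma$ are the second fundamental forms of $M$ in $\mathbb C^{n+k}$ and of $\Gamma$ in $\mathbb R^{n+k}$; and, for $X,Y\in T_p\Gamma$, $$L^{NM}_z(X+iY)=B^\Gamma_p(X,X)+B^\Gamma_p(Y,Y).$$ -/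

import Mathlib

open Set Filter Module Bundle
open scoped Manifold ContDiff Topology

noncomputable section

namespace CRGeometry

/-! ## Submanifolds of a real manifold -/

section Real

variable (E : Type*) [NormedAddCommGroup E] [NormedSpace ℝ E]
  {X : Type*} [TopologicalSpace X] [ChartedSpace E X]

/-- `S` is a smooth embedded submanifold of dimension `d`: near each of its points it is the zero
set of `l = dim X - d` smooth real functions with linearly independent differentials. -/
def IsEmbeddedSubmanifold (S : Set X) (d : ℕ) : Prop :=
  ∀ x ∈ S, ∃ (l : ℕ) (U : Set X) (ρ : X → (Fin l → ℝ)),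
    d + l = finrank ℝ E ∧ IsOpen U ∧ x ∈ U ∧
    ContMDiffOn 𝓘(ℝ, E) 𝓘(ℝ, Fin l → ℝ) ∞ ρ U ∧
    (∀ y ∈ U, y ∈ S ↔ ρ y = 0) ∧
    ∀ y ∈ U, y ∈ S → Function.Surjective (mvfderiv 𝓘(ℝ, E) ρ y)

/-- The tangent space `T_x S`, for `x` in a submanifold `S`, as the common kernel of the
differentials at `x` of the smooth functions that vanish on `S` near `x`. -/
def tangentSpaceOf (S : Set X) (x : X) : Submodule ℝ (TangentSpace 𝓘(ℝ, E) x) where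
  carrier := {v | ∀ f : X → ℝ, ContMDiffAt 𝓘(ℝ, E) 𝓘(ℝ, ℝ) ∞ f x →
    (∀ᶠ y in 𝓝[S] x, f y = 0) → mvfderiv 𝓘(ℝ, E) f x v = 0}
  add_mem' := fun hv hw f hf h0 => by rw [map_add, hv f hf h0, hw f hf h0, add_zero]
  zero_mem' := fun f _ _ => map_zero _
  smul_mem' := fun c v hv f hf h0 => by rw [map_smul, hv f hf h0, smul_zero]

variable [IsManifold 𝓘(ℝ, E) ∞ X]

/-- `Y` is a vector field on `X`, smooth near `x`. -/
def SmoothNear (x : X) (Y : Π y : X, TangentSpace 𝓘(ℝ, E) y) : Prop :=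
  ∀ᶠ y in 𝓝 x, ContMDiffAt 𝓘(ℝ, E) 𝓘(ℝ, E).tangent ∞
    (fun z => (⟨z, Y z⟩ : TangentBundle 𝓘(ℝ, E) X)) y

/-- `Y` is a vector field on `X`, smooth near `x` and tangent to `S` along `S` near `x`, whose
value at `x` is `v`. -/
def IsTangentExtension (S : Set X) (x : X) (v : TangentSpace 𝓘(ℝ, E) x)
    (Y : Π y : X, TangentSpace 𝓘(ℝ, E) y) : Prop :=
  SmoothNear E x Y ∧ (∀ᶠ y in 𝓝[S] x, Y y ∈ tangentSpaceOf E S y) ∧ Y x = v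

/-! ## Second fundamental form and mean curvature -/

variable [FiniteDimensional ℝ E]

instance (x : X) : FiniteDimensional ℝ (TangentSpace 𝓘(ℝ, E) x) :=
  inferInstanceAs (FiniteDimensional ℝ E)

variable [RiemannianBundle (fun x : X => TangentSpace 𝓘(ℝ, E) x)]

/-- The normal component `v^{NS}` of a tangent vector `v` of the ambient manifold at `x ∈ S`. -/
def normalPart (S : Set X) (x : X) (v : TangentSpace 𝓘(ℝ, E) x) : TangentSpace 𝓘(ℝ, E) x :=
  (tangentSpaceOf E S x)ᗮ.starProjection v

/-- The second fundamental form of `S` with respect to the connection `∇`,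
`B_x(u, v) = (∇_u Y)^{NS}` for a vector field `Y` extending `v` and tangent to `S`. That extensions
exist and that the choice does not matter is not built in. -/
def secondFundamentalForm
    (cov : CovariantDerivative 𝓘(ℝ, E) E (fun x : X => TangentSpace 𝓘(ℝ, E) x))
    (S : Set X) (x : X) (u v : TangentSpace 𝓘(ℝ, E) x) : TangentSpace 𝓘(ℝ, E) x :=
  normalPart E S x (cov (Classical.epsilon (IsTangentExtension E S x v)) x u)

/-- The mean curvature vector: the trace of the second fundamental form over an orthonormal basis
of `T_x S`, divided by the dimension of `S`. -/
def meanCurvatureVector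
    (cov : CovariantDerivative 𝓘(ℝ, E) E (fun x : X => TangentSpace 𝓘(ℝ, E) x))
    (S : Set X) (x : X) : TangentSpace 𝓘(ℝ, E) x :=
  (finrank ℝ (tangentSpaceOf E S x) : ℝ)⁻¹ •
    ∑ i, secondFundamentalForm E cov S x
      (stdOrthonormalBasis ℝ (tangentSpaceOf E S x) i : TangentSpace 𝓘(ℝ, E) x)
      (stdOrthonormalBasis ℝ (tangentSpaceOf E S x) i : TangentSpace 𝓘(ℝ, E) x)

/-- `Y` is differentiable at `x`. -/
def DiffAt (x : X) (Y : Π y : X, TangentSpace 𝓘(ℝ, E) y) : Prop :=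
  MDifferentiableAt 𝓘(ℝ, E) 𝓘(ℝ, E).tangent
    (fun z => (⟨z, Y z⟩ : TangentBundle 𝓘(ℝ, E) X)) x

/-- The metric is parallel for `∇`: `u ⟨Y, Z⟩ = ⟨∇_u Y, Z⟩ + ⟨Y, ∇_u Z⟩`. -/
def IsMetricConnection
    (cov : CovariantDerivative 𝓘(ℝ, E) E (fun x : X => TangentSpace 𝓘(ℝ, E) x)) : Prop :=
  ∀ (x : X) (Y Z : Π y : X, TangentSpace 𝓘(ℝ, E) y) (u : TangentSpace 𝓘(ℝ, E) x),
    DiffAt E x Y → DiffAt E x Z →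
    mvfderiv 𝓘(ℝ, E) (fun y => (inner ℝ (Y y) (Z y) : ℝ)) x u =
      inner ℝ (cov Y x u) (Z x) + inner ℝ (Y x) (cov Z x u)

/-- `∇` is the Levi-Civita connection: metric and torsion free. -/
def IsLeviCivita
    (cov : CovariantDerivative 𝓘(ℝ, E) E (fun x : X => TangentSpace 𝓘(ℝ, E) x)) : Prop :=
  IsMetricConnection E cov ∧ cov.torsion = 0

end Real

/-! ## Hermitian manifolds and CR submanifolds -/

section Complex

variable (E : Type*) [NormedAddCommGroup E] [NormedSpace ℂ E]
  {X : Type*} [TopologicalSpace X] [ChartedSpace E X]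

instance realStructure [IsManifold 𝓘(ℂ, E) ω X] : IsManifold 𝓘(ℝ, E) ∞ X := by
  apply isManifold_of_contDiffOn
  intro e e' he he'
  have h := (contDiffGroupoid ω 𝓘(ℂ, E)).compatible he he'
  rw [contDiffGroupoid, mem_groupoid_of_pregroupoid] at h
  have h1 : ContDiffOn ℂ ω (𝓘(ℂ, E) ∘ (e.symm ≫ₕ e') ∘ 𝓘(ℂ, E).symm)
    (𝓘(ℂ, E).symm ⁻¹' (e.symm ≫ₕ e').source ∩ range 𝓘(ℂ, E)) := h.1
  exact (h1.restrict_scalars ℝ).of_le le_top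

variable [IsManifold 𝓘(ℂ, E) ω X]

/-- The complex structure `J`, i.e. multiplication by `i` on the tangent space at `x`. -/
def J (x : X) : TangentSpace 𝓘(ℝ, E) x →L[ℝ] TangentSpace 𝓘(ℝ, E) x :=
  ((Complex.I • ContinuousLinearMap.id ℂ E).restrictScalars ℝ : E →L[ℝ] E)

/-- The vector field `J Y`. -/
def JField (Y : Π y : X, TangentSpace 𝓘(ℝ, E) y) : Π y : X, TangentSpace 𝓘(ℝ, E) y :=
  fun y => J E y (Y y)

/-- The holomorphic tangent space `H_x M = T_x M ∩ J T_x M`. -/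
def holTangent (M : Set X) (x : X) : Submodule ℝ (TangentSpace 𝓘(ℝ, E) x) :=
  tangentSpaceOf E M x ⊓ (tangentSpaceOf E M x).map (J E x).toLinearMap

/-- `M` is a CR submanifold of type `(n, k)`: an embedded submanifold of real dimension `2n + k`
whose holomorphic tangent spaces all have complex dimension `n`. -/
structure IsCRSubmanifold (M : Set X) (n k : ℕ) : Prop where
  submanifold : IsEmbeddedSubmanifold E M (2 * n + k)
  crDim : ∀ x ∈ M, finrank ℝ (holTangent E M x) = 2 * n

/-- `Y` is a vector field on `X`, smooth near `x`, with values in `HM` along `M` near `x`, whose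
value at `x` is `v`. -/
def IsHolTangentExtension (M : Set X) (x : X) (v : TangentSpace 𝓘(ℝ, E) x)
    (Y : Π y : X, TangentSpace 𝓘(ℝ, E) y) : Prop :=
  SmoothNear E x Y ∧ (∀ᶠ y in 𝓝[M] x, Y y ∈ holTangent E M y) ∧ Y x = v

variable [FiniteDimensional ℂ E] [RiemannianBundle (fun x : X => TangentSpace 𝓘(ℝ, E) x)]

/-- `(J [J Y, Y])^{NM}` at `x`. -/
def leviBracket (M : Set X) (x : X) (Y : Π y : X, TangentSpace 𝓘(ℝ, E) y) :
    TangentSpace 𝓘(ℝ, E) x :=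
  normalPart E M x (J E x (VectorField.mlieBracket 𝓘(ℝ, E) (JField E Y) Y x))

/-- The normal-valued Levi form `L^{NM}_x(v) = (J [J Y, Y])^{NM}`, for a section `Y` of `HM`
extending `v`. That extensions exist and that the choice does not matter is not built in. -/
def leviForm (M : Set X) (x : X) (v : TangentSpace 𝓘(ℝ, E) x) : TangentSpace 𝓘(ℝ, E) x :=
  leviBracket E M x (Classical.epsilon (IsHolTangentExtension E M x v))

variable (X) in
/-- The Riemannian metric is Hermitian: `J` is an isometry. -/
def IsHermitian : Prop :=
  ∀ (x : X) (u v : TangentSpace 𝓘(ℝ, E) x), inner ℝ (J E x u) (J E x v) = inner ℝ u v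

/-- The fundamental 2-form `ω(Y, Z) = g(JY, Z)`, evaluated on vector fields. -/
def fundForm (Y Z : Π y : X, TangentSpace 𝓘(ℝ, E) y) : X → ℝ :=
  fun y => inner ℝ (J E y (Y y)) (Z y)

variable (X) in
/-- The metric is Kähler: Hermitian with closed fundamental form. The closedness is expressed by
the invariant formula for the exterior derivative of a 2-form. -/
def IsKaehler : Prop :=
  IsHermitian E X ∧
  ∀ (x : X) (A B C : Π y : X, TangentSpace 𝓘(ℝ, E) y),
    SmoothNear E x A → SmoothNear E x B → SmoothNear E x C →
    mvfderiv 𝓘(ℝ, E) (fundForm E B C) x (A x) - mvfderiv 𝓘(ℝ, E) (fundForm E A C) x (B x)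
      + mvfderiv 𝓘(ℝ, E) (fundForm E A B) x (C x)
      - fundForm E (VectorField.mlieBracket 𝓘(ℝ, E) A B) C x
      + fundForm E (VectorField.mlieBracket 𝓘(ℝ, E) A C) B x
      - fundForm E (VectorField.mlieBracket 𝓘(ℝ, E) B C) A x = 0

/-- `∇` is the Hermitian (Chern) connection of a Hermitian metric: the metric and `J` are parallel
and the `(0,1)`-part of `∇` is `∂̄`, i.e. `∇_{Ju} Y = J ∇_u Y` for each holomorphic vector
field `Y`. -/
structure IsHermitianConnection
    (cov : CovariantDerivative 𝓘(ℝ, E) E (fun x : X => TangentSpace 𝓘(ℝ, E) x)) : Prop where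
  metric : IsMetricConnection E cov
  parallel : ∀ (x : X) (Y : Π y : X, TangentSpace 𝓘(ℝ, E) y) (u : TangentSpace 𝓘(ℝ, E) x),
    DiffAt E x Y → cov (JField E Y) x u = J E x (cov Y x u)
  holomorphic : ∀ (x : X) (Y : Π y : X, TangentSpace 𝓘(ℂ, E) y) (u : TangentSpace 𝓘(ℝ, E) x),
    (∀ᶠ y in 𝓝 x, MDifferentiableAt 𝓘(ℂ, E) 𝓘(ℂ, E).tangent
      (fun z => (⟨z, Y z⟩ : TangentBundle 𝓘(ℂ, E) X)) y) →
    cov (fun y => (Y y : E)) x (J E x u) = J E x (cov (fun y => (Y y : E)) x u)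

end Complex

/-! ## Euclidean spaces -/

section Euclidean

/-- The flat connection of a Euclidean space: the directional derivative of vector fields. -/
def flatConnection (F : Type*) [NormedAddCommGroup F] [NormedSpace ℝ F] :
    CovariantDerivative 𝓘(ℝ, F) F (fun x : F => TangentSpace 𝓘(ℝ, F) x) where
  toFun σ x := (fderiv ℝ (fun y => (σ y : F)) x : F →L[ℝ] F)
  isCovariantDerivativeOnUniv := by
    have key : ∀ (σ : Π y : F, TangentSpace 𝓘(ℝ, F) y) (x : F),
        MDifferentiableAt 𝓘(ℝ, F) 𝓘(ℝ, F).tangent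
          (fun z => (⟨z, σ z⟩ : TangentBundle 𝓘(ℝ, F) F)) x →
        DifferentiableAt ℝ (fun y => (σ y : F)) x := by
      intro σ x h
      rw [mdifferentiableAt_section] at h
      have h' : MDifferentiableAt 𝓘(ℝ, F) 𝓘(ℝ, F) (fun y => (σ y : F)) x := by simpa using h
      exact h'.differentiableAt
    constructor
    · intro σ σ' x h h' _
      exact fderiv_add (key σ x h) (key σ' x h')
    · intro σ g x h hg _
      have hg' : DifferentiableAt ℝ g x := hg.differentiableAt
      refine (fderiv_smul hg' (key σ x h)).trans ?_
      simp only [mvfderiv, mfderiv_eq_fderiv]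
      rfl


/-- The space `ℂ^m` with its Euclidean metric. -/
abbrev Cn (m : ℕ) : Type := EuclideanSpace ℂ (Fin m)

/-- The space `ℝ^m` with its Euclidean metric. -/
abbrev Rn (m : ℕ) : Type := EuclideanSpace ℝ (Fin m)

variable {m : ℕ}

/-- The tangent vector of `ℂ^m` at `x` with components `v`. -/
def toTangent (x : Cn m) (v : Cn m) : TangentSpace 𝓘(ℝ, Cn m) x := v

/-- The real span of `v` and `J v`. -/
def complexLine (x : Cn m) (v : TangentSpace 𝓘(ℝ, Cn m) x) :
    Submodule ℝ (TangentSpace 𝓘(ℝ, Cn m) x) :=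
  Submodule.span ℝ {v, J (Cn m) x v}

/-- The slice of `M` by the affine subspace through `x` with direction `L + N_x M`. -/
def slice (M : Set (Cn m)) (x : Cn m) (L : Submodule ℝ (TangentSpace 𝓘(ℝ, Cn m) x)) :
    Set (Cn m) :=
  {y ∈ M | toTangent x (y - x) ∈ L ⊔ (tangentSpaceOf (Cn m) M x)ᗮ}

/-- `γ` is, near `t = 0`, a geodesic of the submanifold `M` of `ℂ^m`: a smooth curve in `M` whose
acceleration is normal to `M`. -/
def IsGeodesicNearZero (M : Set (Cn m)) (γ : ℝ → Cn m) : Prop :=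
  ∀ᶠ t in 𝓝 (0 : ℝ), ContDiffAt ℝ ∞ γ t ∧ γ t ∈ M ∧
    toTangent (γ t) (deriv (deriv γ) t) ∈ (tangentSpaceOf (Cn m) M (γ t))ᗮ

/-- `S` contains, near `x`, the geodesics of `M` issuing from `x` in all directions of `L`. -/
def ContainsGeodesics (M S : Set (Cn m)) (x : Cn m)
    (L : Submodule ℝ (TangentSpace 𝓘(ℝ, Cn m) x)) : Prop :=
  ∀ v ∈ L, ∃ γ : ℝ → Cn m, IsGeodesicNearZero M γ ∧ γ 0 = x ∧
    toTangent x (deriv γ 0) = v ∧ ∀ᶠ t in 𝓝 (0 : ℝ), γ t ∈ S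

/-- The real part `ℂ^m → ℝ^m`. -/
def rePart (z : Cn m) : Rn m := WithLp.toLp 2 fun j => (z j).re

/-- The imaginary part `ℂ^m → ℝ^m`. -/
def imPart (z : Cn m) : Rn m := WithLp.toLp 2 fun j => (z j).im

/-- The tube `Γ × iℝ^m` over `Γ ⊆ ℝ^m`. -/
def tube (G : Set (Rn m)) : Set (Cn m) := {z | rePart z ∈ G}

/-- The real tangent vector `v` of `ℝ^m`, as a tangent vector of `ℂ^m` at `z`. -/
def complexify (z : Cn m) (v : TangentSpace 𝓘(ℝ, Rn m) (rePart z)) :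
    TangentSpace 𝓘(ℝ, Cn m) z :=
  let w : Rn m := v
  toTangent z (WithLp.toLp 2 fun j => ((w j : ℝ) : ℂ))

end Euclidean

end CRGeometry

end

open CRGeometry

/-!
Let `D` be the flat connection of a chart of the ambient manifold, `chartDeriv`. Every connection is
`D` plus a Christoffel tensor (`cov_eq_chartDeriv_add`), and the Lie bracket of `V` and `W` is
`D_V W - D_W V` (`mlieBracket_eq_chartDeriv`). All assertions reduce to the following fact about `D`
(`chartDeriv_sub_mem_tangentSpaceOf`): if `Y` and `Z` agree at `x` and are tangent to `M` along a
subset `S`, then `D_u Y - D_u Z` is tangent to `M` for `u` tangent to `S` at `x`. Indeed, for a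
defining map `ρ` of `M` the function `dρ(Y - Z)` vanishes on `S`, and differentiating it along `u`
gives `dρ(D_u (Y - Z)) = 0`, because `Y - Z` vanishes at `x`.

This yields at once that the second fundamental form is well defined. In a holomorphic chart `D`
commutes with `J`, so that `J [JY, Y] = D_Y Y + D_{JY} (JY)` (`leviBracket_eq_chartDeriv`), and the
Levi form is the normal part of `D_v Y + D_{Jv} Z` for any fields `Y` and `Z` that extend `v` and
`Jv` and are tangent to `M`. It is thus well defined, and it equals `B(v, v) + B(Jv, Jv)` whenever
the Christoffel tensor `A` of the connection satisfies `A(a, a) + A(Ja, Ja) = 0`. For the Chern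
connection `A` is complex bilinear; for a Kähler metric the Koszul formula turns the identity into
the closedness of the fundamental form. Extensions exist because `TM` and `HM` are, in coordinates,
kernels of smooth families of linear maps of constant rank along `M`
(`exists_contDiffAt_section_ker`), and `T_x M` is the kernel of `dρ` by the theorem on Lagrange
multipliers.

In Euclidean space the Christoffel tensor vanishes. For a surface `S` in `M` with `T_x S` spanned by
`v` and `Jv`, the fields `Y` and `Z` may be chosen tangent to `S`, which gives the formula with the
mean curvature; the slice is a transverse intersection of `M` with an affine subspace. For a tube,
the fields that extend `u + iv` and `-v + iu` may be chosen with constant imaginary part, so that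
only derivatives of fields tangent to the base remain.
-/

noncomputable section

namespace CRGeometry


/-! ### Kernels of families of linear maps of constant rank -/

section Kernel

variable {E F : Type*} [NormedAddCommGroup E] [NormedSpace ℝ E] [FiniteDimensional ℝ E]
  [NormedAddCommGroup F] [NormedSpace ℝ F] [FiniteDimensional ℝ F]

/-- If the rank of a smooth family `B` of linear maps is constant on `P` near `z₀ ∈ P`, then each
vector `a` in the kernel of `B z₀` extends to a smooth map with values in `ker (B z)` for
`z ∈ P`. The rank of `B` may jump outside of `P`, where nothing is claimed. -/
theorem exists_contDiffAt_section_ker {B : E → E →L[ℝ] F} {P : Set E} {z₀ a : E}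
    (hB : ∀ᶠ z in 𝓝 z₀, ContDiffAt ℝ ∞ B z)
    (hrank : ∀ᶠ z in 𝓝[P] z₀, finrank ℝ (B z).ker = finrank ℝ (B z₀).ker)
    (ha : B z₀ a = 0) :
    ∃ y : E → E, (∀ᶠ z in 𝓝 z₀, ContDiffAt ℝ ∞ y z) ∧ (∀ᶠ z in 𝓝[P] z₀, B z (y z) = 0) ∧
      y z₀ = a := by
  set G : Submodule ℝ F := (B z₀).range with hG
  -- After projection to the range of `B z₀`, the family is surjective near `z₀`.
  obtain ⟨p, hp⟩ := G.subtype.exists_leftInverse_of_injective G.ker_subtype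
  obtain ⟨r, hr⟩ := (B z₀).toLinearMap.rangeRestrict.exists_rightInverse_of_surjective
    (LinearMap.range_rangeRestrict _)
  let q : F →L[ℝ] G := p.toContinuousLinearMap
  let R : G →L[ℝ] E := LinearMap.toContinuousLinearMap (r : G →ₗ[ℝ] E)
  have hq : ∀ g : G, q g = g := fun g => LinearMap.congr_fun hp g
  have hR : ∀ g : G, B z₀ (R g) = g := fun g =>
    congrArg Subtype.val (LinearMap.congr_fun hr g)
  let A : E → E →L[ℝ] G := fun z => q ∘L B z
  let C : E → G →L[ℝ] G := fun z => A z ∘L R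
  have hA : ∀ {z}, ContDiffAt ℝ ∞ B z → ContDiffAt ℝ ∞ A z := fun h =>
    contDiffAt_const.clm_comp h
  have hC : ∀ {z}, ContDiffAt ℝ ∞ B z → ContDiffAt ℝ ∞ C z := fun h =>
    (hA h).clm_comp contDiffAt_const
  have hC0 : C z₀ = 1 := by
    ext g
    simp [C, A, hR, hq]
  have hunit : ∀ᶠ z in 𝓝 z₀, IsUnit (C z) := by
    have hcont : ContinuousAt C z₀ := (hC hB.self_of_nhds).continuousAt
    have h1 : IsUnit (C z₀) := hC0 ▸ isUnit_one
    have hmem : {c : G →L[ℝ] G | IsUnit c} ∈ 𝓝 (C z₀) :=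
      (Units.isOpen (R := G →L[ℝ] G)).mem_nhds h1
    exact hcont hmem
  have hdim : finrank ℝ G + finrank ℝ (B z₀).ker = finrank ℝ E :=
    LinearMap.finrank_range_add_finrank_ker (B z₀).toLinearMap
  refine ⟨fun z => a - R (Ring.inverse (C z) (A z a)), ?_, ?_, ?_⟩
  · filter_upwards [hB, hunit] with z hz hu
    obtain ⟨c, hc⟩ := hu
    have hinv : ContDiffAt ℝ ∞ (fun z => Ring.inverse (C z)) z := by
      have h1 := contDiffAt_ringInverse ℝ (n := ∞) (R := G →L[ℝ] G) c
      rw [hc] at h1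
      exact h1.comp z (hC hz)
    exact contDiffAt_const.sub
      (contDiffAt_const.clm_apply (hinv.clm_apply ((hA hz).clm_apply contDiffAt_const)))
  · filter_upwards [hrank, nhdsWithin_le_nhds hunit] with z hz hu
    have hle : (B z).ker ≤ (A z).ker := fun w hw => by
      simp only [LinearMap.mem_ker] at hw ⊢
      change q (B z w) = 0
      rw [show B z w = 0 from hw, map_zero]
    have hsurj : Function.Surjective (A z) := by
      intro g
      refine ⟨R (Ring.inverse (C z) g), ?_⟩
      change (C z * Ring.inverse (C z)) g = g
      rw [Ring.mul_inverse_cancel _ hu]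
      rfl
    have hdim' : finrank ℝ G + finrank ℝ (A z).ker = finrank ℝ E := by
      rw [← LinearMap.finrank_range_add_finrank_ker (A z).toLinearMap,
        LinearMap.range_eq_top.2 hsurj, finrank_top]
    have heq := Submodule.eq_of_le_of_finrank_eq hle (by omega)
    have hmem : a - R (Ring.inverse (C z) (A z a)) ∈ (A z).ker := by
      have h2 : (C z * Ring.inverse (C z)) (A z a) = A z a := by
        rw [Ring.mul_inverse_cancel _ hu]
        rfl
      change A z (a - R (Ring.inverse (C z) (A z a))) = 0
      rw [map_sub, sub_eq_zero]
      exact h2.symm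
    rw [← heq] at hmem
    exact hmem
  · have h3 : A z₀ a = 0 := by simp [A, ha]
    simp [h3]

end Kernel


/-! ### Vector fields in coordinates -/

section Coordinates

variable {E : Type*} [NormedAddCommGroup E] [NormedSpace ℝ E]
  {X : Type*} [TopologicalSpace X] [ChartedSpace E X] [IsManifold 𝓘(ℝ, E) ∞ X]

/-- The differential at `y` of the chart at `x`. It is only meaningful for `y` in the domain of the
chart. -/
def coordMap (x y : X) : TangentSpace 𝓘(ℝ, E) y →L[ℝ] E :=
  (trivializationAt E (TangentSpace 𝓘(ℝ, E)) x).continuousLinearMapAt ℝ y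

/-- The components of the vector field `Y` in the chart at `x`, as a function on `X`. It is only
meaningful on the domain of the chart. -/
def coords (x : X) (Y : Π y : X, TangentSpace 𝓘(ℝ, E) y) (y : X) : E :=
  coordMap x y (Y y)

/-- The vector field with components `w` in the chart at `x`. -/
def ofCoords (x : X) (w : X → E) : Π y : X, TangentSpace 𝓘(ℝ, E) y :=
  fun y => (trivializationAt E (TangentSpace 𝓘(ℝ, E)) x).symmL ℝ y (w y)

/-- The derivative at `x` of the components of `Y` in the chart at `x`, i.e. the covariant
derivative of `Y` for the flat connection of the chart. -/
def chartDeriv (x : X) (Y : Π y : X, TangentSpace 𝓘(ℝ, E) y) :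
    TangentSpace 𝓘(ℝ, E) x →L[ℝ] TangentSpace 𝓘(ℝ, E) x :=
  mvfderiv 𝓘(ℝ, E) (coords x Y) x

theorem symmL_coordMap {x y : X} (hy : y ∈ (chartAt E x).source) (v : TangentSpace 𝓘(ℝ, E) y) :
    (trivializationAt E (TangentSpace 𝓘(ℝ, E)) x).symmL ℝ y (coordMap x y v) = v :=
  (trivializationAt E (TangentSpace 𝓘(ℝ, E)) x).symmL_continuousLinearMapAt (R := ℝ) hy v

theorem coordMap_symmL {x y : X} (hy : y ∈ (chartAt E x).source) (a : E) :
    coordMap x y ((trivializationAt E (TangentSpace 𝓘(ℝ, E)) x).symmL ℝ y a) = a :=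
  (trivializationAt E (TangentSpace 𝓘(ℝ, E)) x).continuousLinearMapAt_symmL (R := ℝ) hy a

theorem coords_ofCoords {x y : X} (hy : y ∈ (chartAt E x).source) (w : X → E) :
    coords x (ofCoords x w) y = w y :=
  coordMap_symmL hy (w y)

theorem ofCoords_coords {x y : X} (hy : y ∈ (chartAt E x).source)
    (Y : Π y : X, TangentSpace 𝓘(ℝ, E) y) : ofCoords x (coords x Y) y = Y y :=
  symmL_coordMap hy (Y y)

theorem coordMap_self (x : X) (v : TangentSpace 𝓘(ℝ, E) x) : coordMap x x v = v := by
  have hx := mem_chart_source E x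
  exact (congrArg (fun L : E →L[ℝ] E => L v)
    (TangentBundle.continuousLinearMapAt_trivializationAt_eq_core (𝕜 := ℝ) (I := 𝓘(ℝ, E)) hx)).trans
    ((tangentBundleCore 𝓘(ℝ, E) X).coordChange_self (achart E x) x hx v)

theorem coords_self (x : X) (Y : Π y : X, TangentSpace 𝓘(ℝ, E) y) : coords x Y x = Y x :=
  coordMap_self x (Y x)

theorem ofCoords_self (x : X) (w : X → E) : ofCoords x w x = w x := by
  rw [← coords_self x (ofCoords x w), coords_ofCoords (mem_chart_source E x)]

theorem coords_add (x : X) (Y Z : Π y : X, TangentSpace 𝓘(ℝ, E) y) :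
    coords x (Y + Z) = coords x Y + coords x Z := by
  funext y
  exact map_add _ _ _

theorem coords_sub (x : X) (Y Z : Π y : X, TangentSpace 𝓘(ℝ, E) y) :
    coords x (Y - Z) = coords x Y - coords x Z := by
  funext y
  exact map_sub _ _ _

theorem coords_smul (x : X) (f : X → ℝ) (Y : Π y : X, TangentSpace 𝓘(ℝ, E) y) :
    coords x (f • Y) = f • coords x Y := by
  funext y
  exact map_smul _ _ _

theorem coords_apply_of_mem {x y : X} (hy : y ∈ (chartAt E x).source)
    (Y : Π y : X, TangentSpace 𝓘(ℝ, E) y) :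
    (trivializationAt E (TangentSpace 𝓘(ℝ, E)) x ⟨y, Y y⟩).2 = coords x Y y := by
  refine Eq.symm ?_
  exact (trivializationAt E (TangentSpace 𝓘(ℝ, E)) x).continuousLinearMapAt_apply_of_mem ℝ hy (Y y)

omit [NormedSpace ℝ E] [IsManifold 𝓘(ℝ, E) ∞ X] in
theorem eventually_mem_chart_source {x y : X} (hy : y ∈ (chartAt E x).source) :
    ∀ᶠ z in 𝓝 y, z ∈ (chartAt E x).source :=
  (chartAt E x).open_source.mem_nhds hy

theorem eventuallyEq_coords {x y : X} (hy : y ∈ (chartAt E x).source)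
    (Y : Π y : X, TangentSpace 𝓘(ℝ, E) y) :
    (fun z => (trivializationAt E (TangentSpace 𝓘(ℝ, E)) x ⟨z, Y z⟩).2) =ᶠ[𝓝 y] coords x Y :=
  (eventually_mem_chart_source hy).mono fun _ hz => coords_apply_of_mem hz Y

theorem contMDiffAt_iff_coords {x y : X} (hy : y ∈ (chartAt E x).source)
    (Y : Π y : X, TangentSpace 𝓘(ℝ, E) y) :
    ContMDiffAt 𝓘(ℝ, E) 𝓘(ℝ, E).tangent ∞
      (fun z => (⟨z, Y z⟩ : TangentBundle 𝓘(ℝ, E) X)) y ↔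
    ContMDiffAt 𝓘(ℝ, E) 𝓘(ℝ, E) ∞ (coords x Y) y :=
  ((trivializationAt E (TangentSpace 𝓘(ℝ, E)) x).contMDiffAt_section_iff
    (IB := 𝓘(ℝ, E)) (n := ∞) (s := Y) hy).trans (eventuallyEq_coords hy Y).contMDiffAt_iff

theorem diffAt_iff_coords {x y : X} (hy : y ∈ (chartAt E x).source)
    (Y : Π y : X, TangentSpace 𝓘(ℝ, E) y) :
    DiffAt E y Y ↔ MDifferentiableAt 𝓘(ℝ, E) 𝓘(ℝ, E) (coords x Y) y :=
  ((trivializationAt E (TangentSpace 𝓘(ℝ, E)) x).mdifferentiableAt_section_iff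
    𝓘(ℝ, E) Y hy).trans (eventuallyEq_coords hy Y).mdifferentiableAt_iff

theorem smoothNear_iff_coords (x : X) (Y : Π y : X, TangentSpace 𝓘(ℝ, E) y) :
    SmoothNear E x Y ↔ ∀ᶠ y in 𝓝 x, ContMDiffAt 𝓘(ℝ, E) 𝓘(ℝ, E) ∞ (coords x Y) y :=
  eventually_congr <| (eventually_mem_chart_source (mem_chart_source E x)).mono fun _ hy =>
    contMDiffAt_iff_coords hy Y

theorem SmoothNear.diffAt {x : X} {Y : Π y : X, TangentSpace 𝓘(ℝ, E) y}
    (h : SmoothNear E x Y) : DiffAt E x Y :=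
  h.self_of_nhds.mdifferentiableAt (by simp)

theorem smoothNear_ofCoords {x : X} {w : X → E}
    (hw : ∀ᶠ y in 𝓝 x, ContMDiffAt 𝓘(ℝ, E) 𝓘(ℝ, E) ∞ w y) : SmoothNear E x (ofCoords x w) := by
  rw [smoothNear_iff_coords]
  filter_upwards [hw, (eventually_mem_chart_source (mem_chart_source E x))] with y hy hys
  refine hy.congr_of_eventuallyEq ?_
  filter_upwards [eventually_mem_chart_source hys] with z hz
  exact coords_ofCoords hz w

theorem mdifferentiableAt_coords {x : X} {Y : Π y : X, TangentSpace 𝓘(ℝ, E) y}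
    (hY : DiffAt E x Y) : MDifferentiableAt 𝓘(ℝ, E) 𝓘(ℝ, E) (coords x Y) x :=
  (diffAt_iff_coords (mem_chart_source E x) Y).1 hY

theorem chartDeriv_add {x : X} {Y Z : Π y : X, TangentSpace 𝓘(ℝ, E) y}
    (hY : DiffAt E x Y) (hZ : DiffAt E x Z) :
    chartDeriv x (Y + Z) = chartDeriv x Y + chartDeriv x Z := by
  unfold chartDeriv
  rw [coords_add]
  exact mvfderiv_add (mdifferentiableAt_coords hY) (mdifferentiableAt_coords hZ)

theorem chartDeriv_sub {x : X} {Y Z : Π y : X, TangentSpace 𝓘(ℝ, E) y}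
    (hY : DiffAt E x Y) (hZ : DiffAt E x Z) :
    chartDeriv x (Y - Z) = chartDeriv x Y - chartDeriv x Z := by
  unfold chartDeriv
  rw [coords_sub]
  exact mvfderiv_sub (mdifferentiableAt_coords hY) (mdifferentiableAt_coords hZ)

theorem chartDeriv_smul {x : X} {f : X → ℝ} {Y : Π y : X, TangentSpace 𝓘(ℝ, E) y}
    (hf : MDifferentiableAt 𝓘(ℝ, E) 𝓘(ℝ, ℝ) f x) (hY : DiffAt E x Y) :
    chartDeriv x (f • Y) = f x • chartDeriv x Y + (mvfderiv 𝓘(ℝ, E) f x).smulRight (Y x) := by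
  unfold chartDeriv
  rw [coords_smul]
  refine (mvfderiv_smul hf (mdifferentiableAt_coords hY)).trans ?_
  rw [coords_self]
  rfl

theorem chartDeriv_ofCoords (x : X) (w : X → E) :
    chartDeriv x (ofCoords x w) = mvfderiv 𝓘(ℝ, E) w x := by
  have h : coords x (ofCoords x w) =ᶠ[𝓝 x] w :=
    (eventually_mem_chart_source (mem_chart_source E x)).mono fun y hy => coords_ofCoords hy w
  unfold chartDeriv mvfderiv
  rw [h.mfderiv_eq]
  rfl

/-- The extension of a tangent vector at `x` to the vector field with constant components in the
chart at `x`. -/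
def constField {x : X} (a : TangentSpace 𝓘(ℝ, E) x) : Π y : X, TangentSpace 𝓘(ℝ, E) y :=
  ofCoords x fun _ => (a : E)

theorem constField_self {x : X} (a : TangentSpace 𝓘(ℝ, E) x) : constField a x = a :=
  ofCoords_self x _

theorem chartDeriv_constField {x : X} (a : TangentSpace 𝓘(ℝ, E) x) :
    chartDeriv x (constField a) = 0 :=
  (chartDeriv_ofCoords x _).trans (mvfderiv_const _)

theorem smoothNear_constField {x : X} (a : TangentSpace 𝓘(ℝ, E) x) :
    SmoothNear E x (constField a) :=
  smoothNear_ofCoords (.of_forall fun _ => contMDiffAt_const)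

/-- Every connection is the flat connection of the chart at `x` plus a tensor: the difference
is computed on the vector field with constant components. -/
theorem cov_eq_chartDeriv_add [FiniteDimensional ℝ E]
    (cov : CovariantDerivative 𝓘(ℝ, E) E (fun x : X => TangentSpace 𝓘(ℝ, E) x))
    {x : X} {Y : Π y : X, TangentSpace 𝓘(ℝ, E) y} (hY : DiffAt E x Y) :
    cov Y x = chartDeriv x Y + cov (constField (Y x)) x := by
  have htens : TensorialAt 𝓘(ℝ, E) E
      (fun Z : Π y : X, TangentSpace 𝓘(ℝ, E) y => cov Z x - chartDeriv x Z) x := by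
    constructor
    · intro f Z hf hZ
      rw [cov.isCovariantDerivativeOnUniv.leibniz hZ hf, chartDeriv_smul hf hZ, smul_sub]
      exact add_sub_add_right_eq_sub _ _ _
    · intro Z Z' hZ hZ'
      rw [cov.isCovariantDerivativeOnUniv.add hZ hZ', chartDeriv_add hZ hZ']
      exact add_sub_add_comm _ _ _ _
  have h := htens.pointwise hY (smoothNear_constField (Y x)).diffAt (constField_self (Y x)).symm
  rw [chartDeriv_constField, sub_zero] at h
  rw [← h]
  exact (add_sub_cancel _ _).symm

/-- The fields with constant components are the pullbacks by the chart of the constant fields of the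
model space, and the bracket commutes with pullback. -/
theorem mlieBracket_constField [FiniteDimensional ℝ E] {x : X} (a b : TangentSpace 𝓘(ℝ, E) x) :
    VectorField.mlieBracket 𝓘(ℝ, E) (constField a) (constField b) x = 0 := by
  have key : ∀ c : E, ofCoords x (fun _ => c) =ᶠ[𝓝 x]
      VectorField.mpullback 𝓘(ℝ, E) 𝓘(ℝ, E) (extChartAt 𝓘(ℝ, E) x) (fun _ => c) := by
    intro c
    filter_upwards [eventually_mem_chart_source (mem_chart_source E x)] with y hy
    refine Eq.symm ?_
    have hy' : y ∈ (extChartAt 𝓘(ℝ, E) x).source := by rwa [extChartAt_source]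
    refine ((isInvertible_mfderiv_extChartAt hy').inverse_apply_eq).2 ?_
    rw [← TangentBundle.continuousLinearMapAt_trivializationAt hy]
    exact (coords_ofCoords hy fun _ => c).symm
  have hc : ∀ (c z : E), DiffAt E z (fun _ : E => c) := by
    exact fun c z => (contMDiffAt_vectorSpace_iff_contDiffAt (n := 1).2
      contDiffAt_const).mdifferentiableAt one_ne_zero
  have : IsManifold 𝓘(ℝ, E) (minSmoothness ℝ 2) X := by
    rw [minSmoothness_of_isRCLikeNormedField]
    infer_instance
  unfold constField
  rw [(key a).mlieBracket_vectorField_eq (key b), ← VectorField.mpullback_mlieBracket (n := 2)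
    (hc a _) (hc b _) contMDiffAt_extChartAt
    (by rw [minSmoothness_of_isRCLikeNormedField])]
  have h0 : ∀ c d : E, VectorField.mlieBracket 𝓘(ℝ, E) (fun _ : E => c) (fun _ : E => d) = 0 := by
    intro c d
    have h1 := VectorField.mlieBracketWithin_eq_lieBracketWithin (𝕜 := ℝ) (V := fun _ : E => c)
      (W := fun _ : E => d) (s := univ)
    funext z
    refine (congrFun h1 z).trans ?_
    simp [VectorField.lieBracketWithin]
    rfl
  rw [h0 a b, VectorField.mpullback_zero]
  rfl

/-- The difference of the two sides is tensorial in `V` and in `W`, and both sides vanish on fields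
with constant components. -/
theorem mlieBracket_eq_chartDeriv [FiniteDimensional ℝ E]
    {x : X} {V W : Π y : X, TangentSpace 𝓘(ℝ, E) y} (hV : DiffAt E x V) (hW : DiffAt E x W) :
    VectorField.mlieBracket 𝓘(ℝ, E) V W x = chartDeriv x W (V x) - chartDeriv x V (W x) := by
  have hskew : ∀ A B : Π y : X, TangentSpace 𝓘(ℝ, E) y,
      VectorField.mlieBracket 𝓘(ℝ, E) A B x - (chartDeriv x B (A x) - chartDeriv x A (B x)) =
      -(VectorField.mlieBracket 𝓘(ℝ, E) B A x -
        (chartDeriv x A (B x) - chartDeriv x B (A x))) := by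
    intro A B
    rw [VectorField.mlieBracket_swap_apply]
    abel
  have htens : ∀ B : Π y : X, TangentSpace 𝓘(ℝ, E) y, TensorialAt 𝓘(ℝ, E) E
      (fun A : Π y : X, TangentSpace 𝓘(ℝ, E) y => VectorField.mlieBracket 𝓘(ℝ, E) A B x -
        (chartDeriv x B (A x) - chartDeriv x A (B x))) x := by
    intro B
    constructor
    · intro f Z hf hZ
      rw [VectorField.mlieBracket_smul_left hf hZ, chartDeriv_smul hf hZ]
      simp only [Pi.smul_apply', map_smul, add_apply,
        smul_apply, ContinuousLinearMap.smulRight_apply]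
      module
    · intro Z Z' hZ hZ'
      rw [VectorField.mlieBracket_add_left hZ hZ', chartDeriv_add hZ hZ']
      simp only [Pi.add_apply, map_add, add_apply]
      abel
  have htens' : ∀ A : Π y : X, TangentSpace 𝓘(ℝ, E) y, TensorialAt 𝓘(ℝ, E) E
      (fun B : Π y : X, TangentSpace 𝓘(ℝ, E) y => VectorField.mlieBracket 𝓘(ℝ, E) A B x -
        (chartDeriv x B (A x) - chartDeriv x A (B x))) x := by
    intro A
    constructor
    · intro f Z hf hZ
      rw [hskew, (htens A).smul hf hZ, hskew A Z, smul_neg]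
    · intro Z Z' hZ hZ'
      rw [hskew, (htens A).add hZ hZ', hskew A Z, hskew A Z', neg_add]
  have h := TensorialAt.pointwise₂ (fun B _ => htens B) (fun A _ => htens' A) hV
    (smoothNear_constField (V x)).diffAt hW (smoothNear_constField (W x)).diffAt
    (constField_self (V x)).symm (constField_self (W x)).symm
  rw [mlieBracket_constField, chartDeriv_constField, chartDeriv_constField] at h
  simpa [sub_eq_zero] using h

end Coordinates


/-! ### Tangent spaces of submanifolds -/

section Submanifold

variable {E : Type*} [NormedAddCommGroup E] [NormedSpace ℝ E]
  {X : Type*} [TopologicalSpace X] [ChartedSpace E X]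
  {F : Type*} [NormedAddCommGroup F] [NormedSpace ℝ F]

/-- On the open set `U`, the set `S` is the zero set of the smooth map `ρ`, which is a submersion
at the points of `S`. -/
structure IsDefiningMap (S U : Set X) (ρ : X → F) : Prop where
  isOpen : IsOpen U
  contMDiffOn : ContMDiffOn 𝓘(ℝ, E) 𝓘(ℝ, F) ∞ ρ U
  mem_iff : ∀ y ∈ U, y ∈ S ↔ ρ y = 0
  surjective : ∀ y ∈ U, y ∈ S → Function.Surjective (mvfderiv 𝓘(ℝ, E) ρ y)

theorem IsEmbeddedSubmanifold.exists_isDefiningMap {S : Set X} {d : ℕ}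
    (h : IsEmbeddedSubmanifold E S d) {x : X} (hx : x ∈ S) :
    ∃ (l : ℕ) (U : Set X) (ρ : X → (Fin l → ℝ)), d + l = finrank ℝ E ∧ x ∈ U ∧
      IsDefiningMap (E := E) S U ρ := by
  obtain ⟨l, U, ρ, hl, hU, hxU, hρ, hz, hs⟩ := h x hx
  exact ⟨l, U, ρ, hl, hxU, hU, hρ, hz, hs⟩

theorem IsDefiningMap.contMDiffAt {S U : Set X} {ρ : X → F} (h : IsDefiningMap (E := E) S U ρ)
    {y : X} (hy : y ∈ U) : ContMDiffAt 𝓘(ℝ, E) 𝓘(ℝ, F) ∞ ρ y :=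
  h.contMDiffOn.contMDiffAt (h.isOpen.mem_nhds hy)

theorem IsDefiningMap.eventually_eq_zero {S U : Set X} {ρ : X → F}
    (h : IsDefiningMap (E := E) S U ρ) {y : X} (hy : y ∈ U) : ∀ᶠ z in 𝓝[S] y, ρ z = 0 := by
  filter_upwards [nhdsWithin_le_nhds (h.isOpen.mem_nhds hy), self_mem_nhdsWithin] with z hz hzS
  exact (h.mem_iff z hz).1 hzS

theorem mvfderiv_clm_comp {G : Type*} [NormedAddCommGroup G] [NormedSpace ℝ G] (Λ : F →L[ℝ] G)
    {f : X → F} {x : X} (hf : MDifferentiableAt 𝓘(ℝ, E) 𝓘(ℝ, F) f x)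
    (v : TangentSpace 𝓘(ℝ, E) x) :
    mvfderiv 𝓘(ℝ, E) (fun y => Λ (f y)) x v = Λ (mvfderiv 𝓘(ℝ, E) f x v) := by
  have h := (Λ.hasMFDerivAt (x := f x)).comp x hf.hasMFDerivAt
  have h2 : mfderiv 𝓘(ℝ, E) 𝓘(ℝ, G) (fun y => Λ (f y)) x =
    Λ ∘L (mfderiv 𝓘(ℝ, E) 𝓘(ℝ, F) f x) := h.mfderiv
  unfold mvfderiv
  rw [h2]
  rfl

theorem mvfderiv_congr {f g : X → F} {x : X} (h : f =ᶠ[𝓝 x] g) :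
    mvfderiv 𝓘(ℝ, E) f x = mvfderiv 𝓘(ℝ, E) g x := by
  unfold mvfderiv
  rw [h.mfderiv_eq]
  rfl

theorem mvfderiv_eq_fderiv_chart {f : X → F} {x : X}
    (hf : MDifferentiableAt 𝓘(ℝ, E) 𝓘(ℝ, F) f x) (v : TangentSpace 𝓘(ℝ, E) x) :
    mvfderiv 𝓘(ℝ, E) f x v =
      fderiv ℝ (f ∘ (extChartAt 𝓘(ℝ, E) x).symm) (extChartAt 𝓘(ℝ, E) x x) v := by
  have h := hf.mvfderiv
  rw [modelWithCornersSelf_coe, range_id, fderivWithin_univ] at h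
  exact congrArg (fun L : E →L[ℝ] F => L v) h

variable [IsManifold 𝓘(ℝ, E) ∞ X]

theorem contDiffAt_comp_extChartAt_symm {f : X → F} {x y : X} {n : WithTop ℕ∞} (hn : n ≤ ∞)
    (hy : y ∈ (chartAt E x).source) (hf : ContMDiffAt 𝓘(ℝ, E) 𝓘(ℝ, F) n f y) :
    ContDiffAt ℝ n (f ∘ (extChartAt 𝓘(ℝ, E) x).symm) (extChartAt 𝓘(ℝ, E) x y) := by
  have hy' : y ∈ (extChartAt 𝓘(ℝ, E) x).source := by rwa [extChartAt_source]
  have h1 : ContMDiffAt 𝓘(ℝ, E) 𝓘(ℝ, E) n (extChartAt 𝓘(ℝ, E) x).symm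
      (extChartAt 𝓘(ℝ, E) x y) :=
    ((contMDiffOn_extChartAt_symm (n := ∞) x).contMDiffAt
      ((isOpen_extChartAt_target x).mem_nhds ((extChartAt 𝓘(ℝ, E) x).map_source hy'))).of_le hn
  rw [← contMDiffAt_iff_contDiffAt]
  refine ContMDiffAt.comp _ ?_ h1
  rwa [(extChartAt 𝓘(ℝ, E) x).left_inv hy']

theorem mvfderiv_eq_fderiv_coordMap {f : X → F} {x y : X} (hy : y ∈ (chartAt E x).source)
    (hf : MDifferentiableAt 𝓘(ℝ, E) 𝓘(ℝ, F) f y) (v : TangentSpace 𝓘(ℝ, E) y) :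
    mvfderiv 𝓘(ℝ, E) f y v =
      fderiv ℝ (f ∘ (extChartAt 𝓘(ℝ, E) x).symm) (extChartAt 𝓘(ℝ, E) x y) (coordMap x y v) := by
  have hy' : y ∈ (extChartAt 𝓘(ℝ, E) x).source := by rwa [extChartAt_source]
  have hz := (extChartAt 𝓘(ℝ, E) x).map_source hy'
  have h1 : MDifferentiableAt 𝓘(ℝ, E) 𝓘(ℝ, E) (extChartAt 𝓘(ℝ, E) x).symm
      (extChartAt 𝓘(ℝ, E) x y) :=
    ((contMDiffOn_extChartAt_symm (n := 1) x).contMDiffAt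
      ((isOpen_extChartAt_target x).mem_nhds hz)).mdifferentiableAt one_ne_zero
  have h3 := TangentBundle.symmL_trivializationAt (𝕜 := ℝ) (I := 𝓘(ℝ, E)) hy
  rw [modelWithCornersSelf_coe, range_id, mfderivWithin_univ] at h3
  let D : E →L[ℝ] E := mfderiv 𝓘(ℝ, E) 𝓘(ℝ, E) (extChartAt 𝓘(ℝ, E) x).symm (extChartAt 𝓘(ℝ, E) x y)
  let D' : E →L[ℝ] F := mfderiv 𝓘(ℝ, E) 𝓘(ℝ, F) f y
  have h4 : D (coordMap x y v) = v :=
    (congrArg (fun L : E →L[ℝ] E => L (coordMap x y v)) h3).symm.trans (symmL_coordMap hy v)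
  have h5 : fderiv ℝ (f ∘ (extChartAt 𝓘(ℝ, E) x).symm) (extChartAt 𝓘(ℝ, E) x y) = D' ∘L D := by
    have hf' : HasMFDerivAt 𝓘(ℝ, E) 𝓘(ℝ, F) f
        ((extChartAt 𝓘(ℝ, E) x).symm (extChartAt 𝓘(ℝ, E) x y)) D' := by
      rw [(extChartAt 𝓘(ℝ, E) x).left_inv hy']
      exact hf.hasMFDerivAt
    rw [← mfderiv_eq_fderiv]
    exact (hf'.comp _ h1.hasMFDerivAt).mfderiv
  rw [h5]
  exact (congrArg D' h4).symm

omit [IsManifold 𝓘(ℝ, E) ∞ X] in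
theorem tangentSpaceOf_le_ker {S : Set X} {ρ : X → F} {x : X}
    (hρ : ContMDiffAt 𝓘(ℝ, E) 𝓘(ℝ, F) ∞ ρ x) (h0 : ∀ᶠ y in 𝓝[S] x, ρ y = 0)
    {v : TangentSpace 𝓘(ℝ, E) x} (hv : v ∈ tangentSpaceOf E S x) :
    mvfderiv 𝓘(ℝ, E) ρ x v = 0 := by
  refine SeparatingDual.eq_zero_of_forall_dual_eq_zero (R := ℝ) fun Λ => ?_
  rw [← mvfderiv_clm_comp Λ (hρ.mdifferentiableAt (by simp))]
  refine hv _ ?_ ?_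
  · exact (Λ.contDiff.contMDiff.contMDiffAt (x := ρ x)).comp x hρ
  · filter_upwards [h0] with y hy
    rw [hy, map_zero]

variable [FiniteDimensional ℝ E] [FiniteDimensional ℝ F]

/-- The tangent space of a submanifold is the kernel of the differential of a defining map. The
inclusion `⊇` is the theorem on Lagrange multipliers: a function that vanishes on `S` has an
extremum under the constraint `ρ = 0`. -/
theorem IsDefiningMap.mem_tangentSpaceOf_iff {S U : Set X} {ρ : X → F}
    (h : IsDefiningMap (E := E) S U ρ) {x : X} (hxU : x ∈ U) (hxS : x ∈ S)
    {v : TangentSpace 𝓘(ℝ, E) x} :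
    v ∈ tangentSpaceOf E S x ↔ mvfderiv 𝓘(ℝ, E) ρ x v = 0 := by
  refine ⟨tangentSpaceOf_le_ker (h.contMDiffAt hxU) (h.eventually_eq_zero hxU),
    fun hv f hf h0 => ?_⟩
  set φ := extChartAt 𝓘(ℝ, E) x with hφ
  have hsrc := mem_chart_source E x
  have hinv : φ.symm (φ x) = x := extChartAt_to_inv x
  have hρd : MDifferentiableAt 𝓘(ℝ, E) 𝓘(ℝ, F) ρ x :=
    (h.contMDiffAt hxU).mdifferentiableAt (by simp)
  have hfd : MDifferentiableAt 𝓘(ℝ, E) 𝓘(ℝ, ℝ) f x := hf.mdifferentiableAt (by simp)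
  have hρs := (contDiffAt_comp_extChartAt_symm le_rfl hsrc (h.contMDiffAt hxU)).hasStrictFDerivAt
    (by simp)
  have hfs := (contDiffAt_comp_extChartAt_symm le_rfl hsrc hf).hasStrictFDerivAt (by simp)
  have hcont : Tendsto φ.symm (𝓝 (φ x)) (𝓝 x) := by
    have := (continuousAt_extChartAt_symm (I := 𝓘(ℝ, E)) x).tendsto
    rwa [← hφ, hinv] at this
  have hext : IsLocalExtrOn (f ∘ φ.symm) {z | (ρ ∘ φ.symm) z = (ρ ∘ φ.symm) (φ x)} (φ x) := by
    refine Or.inl ?_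
    have hfx : f x = 0 := (eventually_nhdsWithin_iff.1 h0).self_of_nhds hxS
    have h1 := hcont.eventually ((eventually_nhdsWithin_iff.1 h0).and (h.isOpen.mem_nhds hxU))
    refine eventually_nhdsWithin_iff.2 ?_
    filter_upwards [h1] with z hz hzρ
    have hzS : φ.symm z ∈ S := by
      rw [h.mem_iff _ hz.2]
      have : ρ (φ.symm z) = ρ (φ.symm (φ x)) := hzρ
      rw [this, hinv]
      exact (h.mem_iff x hxU).1 hxS
    simp only [Function.comp_apply, hinv, hfx, hz.1 hzS, le_refl]
  obtain ⟨Λ, c, hne, hΛ⟩ := hext.exists_linear_map_of_hasStrictFDerivAt hρs hfs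
  have hΛ' : ∀ w : TangentSpace 𝓘(ℝ, E) x,
      Λ (mvfderiv 𝓘(ℝ, E) ρ x w) + c * mvfderiv 𝓘(ℝ, E) f x w = 0 := fun w => by
    rw [mvfderiv_eq_fderiv_chart hρd, mvfderiv_eq_fderiv_chart hfd]
    exact hΛ w
  have hc : c ≠ 0 := by
    rintro rfl
    refine hne (Prod.ext (LinearMap.ext fun a => ?_) rfl)
    obtain ⟨w, rfl⟩ := h.surjective x hxU hxS a
    simpa using hΛ' w
  have := hΛ' v
  rw [hv, map_zero, zero_add] at this
  exact (mul_eq_zero.1 this).resolve_left hc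

theorem IsDefiningMap.finrank_tangentSpaceOf {S U : Set X} {ρ : X → F}
    (h : IsDefiningMap (E := E) S U ρ) {x : X} (hxU : x ∈ U) (hxS : x ∈ S) :
    finrank ℝ (tangentSpaceOf E S x) + finrank ℝ F = finrank ℝ E := by
  have h1 : tangentSpaceOf E S x = (mvfderiv 𝓘(ℝ, E) ρ x).ker := by
    ext v
    exact h.mem_tangentSpaceOf_iff hxU hxS
  have h2 := LinearMap.finrank_range_add_finrank_ker (mvfderiv 𝓘(ℝ, E) ρ x).toLinearMap
  rw [LinearMap.range_eq_top.2 (h.surjective x hxU hxS), finrank_top] at h2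
  rw [h1, add_comm]
  exact h2

theorem IsEmbeddedSubmanifold.finrank_tangentSpaceOf {S : Set X} {d : ℕ}
    (h : IsEmbeddedSubmanifold E S d) {x : X} (hx : x ∈ S) :
    finrank ℝ (tangentSpaceOf E S x) = d := by
  obtain ⟨l, U, ρ, hl, hxU, hρ⟩ := h.exists_isDefiningMap hx
  have := hρ.finrank_tangentSpaceOf hxU hx
  rw [finrank_fin_fun] at this
  omega

omit [IsManifold 𝓘(ℝ, E) ∞ X] [FiniteDimensional ℝ E] in
/-- Submanifolds can be given by defining maps with values in any vector space. -/
theorem isEmbeddedSubmanifold_of_isDefiningMap {S : Set X} {d : ℕ}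
    (hd : d + finrank ℝ F = finrank ℝ E)
    (h : ∀ x ∈ S, ∃ (U : Set X) (ρ : X → F), x ∈ U ∧ IsDefiningMap (E := E) S U ρ) :
    IsEmbeddedSubmanifold E S d := by
  intro x hx
  obtain ⟨U, ρ, hxU, hρ⟩ := h x hx
  let e : F ≃L[ℝ] (Fin (finrank ℝ F) → ℝ) := (finBasis ℝ F).equivFunL
  have hd' : ∀ y ∈ U, ∀ v, mvfderiv 𝓘(ℝ, E) (fun z => e (ρ z)) y v =
      e (mvfderiv 𝓘(ℝ, E) ρ y v) := fun y hy v =>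
    mvfderiv_clm_comp e.toContinuousLinearMap
      ((hρ.contMDiffAt hy).mdifferentiableAt (by simp)) v
  refine ⟨finrank ℝ F, U, fun y => e (ρ y), hd, hρ.isOpen, hxU, ?_, ?_, ?_⟩
  · exact e.contDiff.contMDiff.comp_contMDiffOn hρ.contMDiffOn
  · intro y hy
    rw [hρ.mem_iff y hy]
    exact e.map_eq_zero_iff.symm
  · intro y hy hyS b
    obtain ⟨v, hv⟩ := hρ.surjective y hy hyS (e.symm b)
    exact ⟨v, by rw [hd' y hy, hv, e.apply_symm_apply]⟩

end Submanifold


/-! ### Extensions of tangent vectors -/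

section Extension

variable {E : Type*} [NormedAddCommGroup E] [NormedSpace ℝ E]
  {X : Type*} [TopologicalSpace X] [ChartedSpace E X] [IsManifold 𝓘(ℝ, E) ∞ X]
  {F : Type*} [NormedAddCommGroup F] [NormedSpace ℝ F]

omit [IsManifold 𝓘(ℝ, E) ∞ X] in
theorem tendsto_extChartAt_symm (x : X) :
    Tendsto (extChartAt 𝓘(ℝ, E) x).symm (𝓝 (extChartAt 𝓘(ℝ, E) x x)) (𝓝 x) := by
  have := (continuousAt_extChartAt_symm (I := 𝓘(ℝ, E)) x).tendsto
  rwa [extChartAt_to_inv] at this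

theorem IsDefiningMap.eventually_contDiffAt_fderiv {S U : Set X} {ρ : X → F}
    (h : IsDefiningMap (E := E) S U ρ) {x : X} (hxU : x ∈ U) :
    ∀ᶠ z in 𝓝 (extChartAt 𝓘(ℝ, E) x x),
      ContDiffAt ℝ ∞ (fderiv ℝ (ρ ∘ (extChartAt 𝓘(ℝ, E) x).symm)) z := by
  filter_upwards [(tendsto_extChartAt_symm x).eventually (h.isOpen.mem_nhds hxU),
    (tendsto_extChartAt_symm x).eventually (eventually_mem_chart_source (mem_chart_source E x)),
    extChartAt_target_mem_nhds (I := 𝓘(ℝ, E)) x] with z hzU hzs hzt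
  have h1 := contDiffAt_comp_extChartAt_symm le_rfl hzs (h.contMDiffAt hzU)
  rw [(extChartAt 𝓘(ℝ, E) x).right_inv hzt] at h1
  exact h1.fderiv_right (by simp)

/-- If a family of subspaces `D` of the tangent spaces is given along `S` by the kernels of a
smooth family `B` of linear maps, written in the chart at `x`, and has constant rank, then the
vectors in `D x` extend to smooth vector fields with values in `D` along `S`. -/
theorem exists_extension_of_ker [FiniteDimensional ℝ E] [FiniteDimensional ℝ F] {S : Set X} {x : X}
    (hxS : x ∈ S)
    {B : E → E →L[ℝ] F} (hB : ∀ᶠ z in 𝓝 (extChartAt 𝓘(ℝ, E) x x), ContDiffAt ℝ ∞ B z)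
    (D : Π y : X, Submodule ℝ (TangentSpace 𝓘(ℝ, E) y))
    (hD : ∀ᶠ y in 𝓝[S] x, ∀ v : TangentSpace 𝓘(ℝ, E) y,
      v ∈ D y ↔ B (extChartAt 𝓘(ℝ, E) x y) (coordMap x y v) = 0)
    (hrank : ∀ᶠ y in 𝓝[S] x, finrank ℝ (D y) = finrank ℝ (D x))
    {v : TangentSpace 𝓘(ℝ, E) x} (hv : v ∈ D x) :
    ∃ Y : Π y : X, TangentSpace 𝓘(ℝ, E) y,
      SmoothNear E x Y ∧ (∀ᶠ y in 𝓝[S] x, Y y ∈ D y) ∧ Y x = v := by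
  set φ := extChartAt 𝓘(ℝ, E) x with hφ
  have hsrc := mem_chart_source E x
  have hfin : ∀ y ∈ (chartAt E x).source, (∀ v : TangentSpace 𝓘(ℝ, E) y,
      v ∈ D y ↔ B (φ y) (coordMap x y v) = 0) →
      finrank ℝ (B (φ y)).ker = finrank ℝ (D y) := by
    intro y hy hDy
    let e : TangentSpace 𝓘(ℝ, E) y ≃ₗ[ℝ] E := LinearEquiv.ofLinearMap
      (coordMap x y).toLinearMap
      ((trivializationAt E (TangentSpace 𝓘(ℝ, E)) x).symmL ℝ y).toLinearMap
      (LinearMap.ext fun a => coordMap_symmL hy a) (LinearMap.ext fun v => symmL_coordMap hy v)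
    have he : (D y) = (B (φ y)).ker.comap e.toLinearMap := by
      ext w
      exact hDy w
    have he' : (D y).map e.toLinearMap = (B (φ y)).ker := by
      rw [he]
      exact Submodule.map_comap_eq_of_surjective e.surjective _
    rw [← he']
    exact (LinearEquiv.finrank_map_eq e (D y))
  have hDx := hD.self_of_nhdsWithin hxS
  have htend : Tendsto φ.symm (𝓝[φ.symm ⁻¹' S] (φ x)) (𝓝[S] x) :=
    tendsto_nhdsWithin_iff.2 ⟨(tendsto_extChartAt_symm x).mono_left nhdsWithin_le_nhds,
      self_mem_nhdsWithin⟩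
  have hrank' : ∀ᶠ z in 𝓝[φ.symm ⁻¹' S] (φ x),
      finrank ℝ (B z).ker = finrank ℝ (B (φ x)).ker := by
    filter_upwards [htend.eventually (hD.and (hrank.and
      (nhdsWithin_le_nhds (eventually_mem_chart_source hsrc)))),
      nhdsWithin_le_nhds (extChartAt_target_mem_nhds (I := 𝓘(ℝ, E)) x)] with z hz hzt
    have h1 := hfin _ hz.2.2 hz.1
    rw [φ.right_inv hzt] at h1
    rw [h1, hz.2.1, hfin x hsrc hDx]
  have hv0 : B (φ x) (v : E) = 0 := by
    have := (hDx v).1 hv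
    rwa [coordMap_self] at this
  obtain ⟨w, hw, hwS, hwx⟩ := exists_contDiffAt_section_ker hB hrank' hv0
  have hφc : Tendsto φ (𝓝 x) (𝓝 (φ x)) := (continuousAt_extChartAt (I := 𝓘(ℝ, E)) x).tendsto
  refine ⟨ofCoords x (w ∘ φ), smoothNear_ofCoords ?_, ?_, ?_⟩
  · filter_upwards [hφc.eventually hw, eventually_mem_chart_source hsrc] with y hy hys
    exact hy.contMDiffAt.comp y (contMDiffAt_extChartAt' hys)
  · have htend' : Tendsto φ (𝓝[S] x) (𝓝[φ.symm ⁻¹' S] (φ x)) := by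
      refine tendsto_nhdsWithin_iff.2 ⟨hφc.mono_left nhdsWithin_le_nhds, ?_⟩
      filter_upwards [self_mem_nhdsWithin,
        nhdsWithin_le_nhds (extChartAt_source_mem_nhds (I := 𝓘(ℝ, E)) x)] with y hyS hys
      rw [mem_preimage, φ.left_inv hys]
      exact hyS
    filter_upwards [htend'.eventually hwS, hD,
      nhdsWithin_le_nhds (eventually_mem_chart_source hsrc)] with y hy hDy hys
    rw [hDy]
    exact (congrArg (B (φ y)) (coords_ofCoords hys (w ∘ φ))).trans hy
  · rw [ofCoords_self]
    exact hwx

variable [FiniteDimensional ℝ E]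

theorem IsDefiningMap.mem_tangentSpaceOf_iff_coordMap [FiniteDimensional ℝ F] {S U : Set X}
    {ρ : X → F} (h : IsDefiningMap (E := E) S U ρ) {x y : X} (hy : y ∈ (chartAt E x).source)
    (hyU : y ∈ U) (hyS : y ∈ S) (v : TangentSpace 𝓘(ℝ, E) y) :
    v ∈ tangentSpaceOf E S y ↔ fderiv ℝ (ρ ∘ (extChartAt 𝓘(ℝ, E) x).symm)
      (extChartAt 𝓘(ℝ, E) x y) (coordMap x y v) = 0 := by
  rw [h.mem_tangentSpaceOf_iff hyU hyS,
    mvfderiv_eq_fderiv_coordMap hy ((h.contMDiffAt hyU).mdifferentiableAt (by simp)) v]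

theorem exists_isTangentExtension {S : Set X} {d : ℕ} (hS : IsEmbeddedSubmanifold E S d) {x : X}
    (hx : x ∈ S) {v : TangentSpace 𝓘(ℝ, E) x} (hv : v ∈ tangentSpaceOf E S x) :
    ∃ Y, IsTangentExtension E S x v Y := by
  obtain ⟨l, U, ρ, -, hxU, hρ⟩ := hS.exists_isDefiningMap hx
  refine exists_extension_of_ker hx (hρ.eventually_contDiffAt_fderiv hxU)
    (fun y => tangentSpaceOf E S y) ?_ ?_ hv
  · filter_upwards [self_mem_nhdsWithin, nhdsWithin_le_nhds (hρ.isOpen.mem_nhds hxU),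
      nhdsWithin_le_nhds (eventually_mem_chart_source (mem_chart_source E x))] with y hyS hyU hys v
    exact hρ.mem_tangentSpaceOf_iff_coordMap hys hyU hyS v
  · filter_upwards [self_mem_nhdsWithin] with y hyS
    rw [hS.finrank_tangentSpaceOf hyS, hS.finrank_tangentSpaceOf hx]

/-! ### The second fundamental form -/

omit [FiniteDimensional ℝ E] in
/-- If `W` vanishes at `x` and `f` is constant along `W` on `S`, then `f` is constant to first
order along the derivatives of `W` in the directions tangent to `S`: differentiate `df(W) = 0`. -/
theorem mvfderiv_chartDeriv_eq_zero {f : X → F} {x : X} {S : Set X}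
    (hf : ContMDiffAt 𝓘(ℝ, E) 𝓘(ℝ, F) ∞ f x) {W : Π y : X, TangentSpace 𝓘(ℝ, E) y}
    (hW : SmoothNear E x W) (hWx : W x = 0)
    (h0 : ∀ᶠ y in 𝓝[S] x, mvfderiv 𝓘(ℝ, E) f y (W y) = 0)
    {u : TangentSpace 𝓘(ℝ, E) x} (hu : u ∈ tangentSpaceOf E S x) :
    mvfderiv 𝓘(ℝ, E) f x (chartDeriv x W u) = 0 := by
  set φ := extChartAt 𝓘(ℝ, E) x with hφ
  have hsrc := mem_chart_source E x
  set A := fderiv ℝ (f ∘ φ.symm) with hA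
  have hAc : ContDiffAt ℝ ∞ A (φ x) :=
    (contDiffAt_comp_extChartAt_symm le_rfl hsrc hf).fderiv_right (by simp)
  have hWc : ContMDiffAt 𝓘(ℝ, E) 𝓘(ℝ, E) ∞ (coords x W) x :=
    ((smoothNear_iff_coords x W).1 hW).self_of_nhds
  have hWc' := contDiffAt_comp_extChartAt_symm le_rfl hsrc hWc
  have hAφ : ContMDiffAt 𝓘(ℝ, E) 𝓘(ℝ, E →L[ℝ] F) ∞ (fun y => A (φ y)) x :=
    hAc.contMDiffAt.comp x contMDiffAt_extChartAt
  have hh : ContMDiffAt 𝓘(ℝ, E) 𝓘(ℝ, F) ∞ (fun y => A (φ y) (coords x W y)) x :=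
    hAφ.clm_apply hWc
  have hd : ∀ᶠ y in 𝓝 x, MDifferentiableAt 𝓘(ℝ, E) 𝓘(ℝ, F) f y :=
    ((contMDiffAt_iff_contMDiffAt_nhds (n := 1) (by simp)).1 (hf.of_le (by simp))).mono
      fun y hy => hy.mdifferentiableAt one_ne_zero
  have hzero : ∀ᶠ y in 𝓝[S] x, A (φ y) (coords x W y) = 0 := by
    filter_upwards [h0, nhdsWithin_le_nhds hd,
      nhdsWithin_le_nhds (eventually_mem_chart_source hsrc)] with y hy hyd hys
    rw [← hy, mvfderiv_eq_fderiv_coordMap hys hyd]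
    rfl
  have h1 := tangentSpaceOf_le_ker hh hzero hu
  rw [mvfderiv_eq_fderiv_chart (hh.mdifferentiableAt (by simp))] at h1
  have hcomp : (fun y => A (φ y) (coords x W y)) ∘ φ.symm =ᶠ[𝓝 (φ x)]
      fun z => A z ((coords x W ∘ φ.symm) z) := by
    filter_upwards [extChartAt_target_mem_nhds (I := 𝓘(ℝ, E)) x] with z hz
    simp only [Function.comp_apply, φ.right_inv hz]
  have h0' : (coords x W ∘ φ.symm) (φ x) = 0 := by
    rw [Function.comp_apply, extChartAt_to_inv, coords_self, hWx]
    rfl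
  have h2 : fderiv ℝ ((fun y => A (φ y) (coords x W y)) ∘ φ.symm) (φ x) =
      (A (φ x)).comp (fderiv ℝ (coords x W ∘ φ.symm) (φ x)) := by
    rw [hcomp.fderiv_eq, fderiv_clm_apply (hAc.differentiableAt (by simp))
      (hWc'.differentiableAt (by simp)), h0', map_zero, add_zero]
  rw [mvfderiv_eq_fderiv_chart (hf.mdifferentiableAt (by simp))]
  refine Eq.trans ?_ ((congrArg (fun L : E →L[ℝ] F => L u) h2).symm.trans h1)
  exact congrArg (A (φ x)) (mvfderiv_eq_fderiv_chart (hWc.mdifferentiableAt (by simp)) u)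

/-- Two vector fields that agree at `x` and are tangent to `M` along a subset `S` have the same
derivatives at `x` in the directions tangent to `S`, up to vectors tangent to `M`. -/
theorem chartDeriv_sub_mem_tangentSpaceOf {M S : Set X} {d : ℕ} (hM : IsEmbeddedSubmanifold E M d)
    {x : X} (hx : x ∈ M) {Y Z : Π y : X, TangentSpace 𝓘(ℝ, E) y}
    (hY : SmoothNear E x Y) (hZ : SmoothNear E x Z)
    (hYM : ∀ᶠ y in 𝓝[S] x, Y y ∈ tangentSpaceOf E M y)
    (hZM : ∀ᶠ y in 𝓝[S] x, Z y ∈ tangentSpaceOf E M y) (hYZ : Y x = Z x)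
    {u : TangentSpace 𝓘(ℝ, E) x} (hu : u ∈ tangentSpaceOf E S x) :
    chartDeriv x Y u - chartDeriv x Z u ∈ tangentSpaceOf E M x := by
  obtain ⟨l, U, ρ, -, hxU, hρ⟩ := hM.exists_isDefiningMap hx
  have hsub : SmoothNear E x (Y - Z) := by
    rw [smoothNear_iff_coords] at hY hZ ⊢
    filter_upwards [hY, hZ] with y hy hz
    rw [coords_sub]
    exact hy.sub hz
  have h1 : chartDeriv x Y u - chartDeriv x Z u = chartDeriv x (Y - Z) u := by
    rw [chartDeriv_sub hY.diffAt hZ.diffAt]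
    rfl
  rw [h1, hρ.mem_tangentSpaceOf_iff hxU hx]
  refine mvfderiv_chartDeriv_eq_zero (S := S) (hρ.contMDiffAt hxU) hsub (sub_eq_zero.2 hYZ) ?_ hu
  filter_upwards [hYM, hZM, nhdsWithin_le_nhds (hρ.isOpen.mem_nhds hxU)] with y hyY hyZ hyU
  exact tangentSpaceOf_le_ker (hρ.contMDiffAt hyU) (hρ.eventually_eq_zero hyU)
    (Submodule.sub_mem _ hyY hyZ)

theorem cov_sub_eq_chartDeriv_sub
    (cov : CovariantDerivative 𝓘(ℝ, E) E (fun x : X => TangentSpace 𝓘(ℝ, E) x))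
    {x : X} {Y Z : Π y : X, TangentSpace 𝓘(ℝ, E) y} (hY : DiffAt E x Y) (hZ : DiffAt E x Z)
    (hYZ : Y x = Z x) (u : TangentSpace 𝓘(ℝ, E) x) :
    cov Y x u - cov Z x u = chartDeriv x Y u - chartDeriv x Z u := by
  rw [cov_eq_chartDeriv_add cov hY, cov_eq_chartDeriv_add cov hZ, hYZ]
  exact add_sub_add_right_eq_sub _ _ _

variable [RiemannianBundle (fun x : X => TangentSpace 𝓘(ℝ, E) x)]

omit [IsManifold 𝓘(ℝ, E) ∞ X] in
theorem normalPart_eq_zero {S : Set X} {x : X} {v : TangentSpace 𝓘(ℝ, E) x}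
    (hv : v ∈ tangentSpaceOf E S x) : normalPart E S x v = 0 :=
  Submodule.starProjection_orthogonal_apply_eq_zero hv

omit [IsManifold 𝓘(ℝ, E) ∞ X] in
theorem normalPart_add (S : Set X) (x : X) (v w : TangentSpace 𝓘(ℝ, E) x) :
    normalPart E S x (v + w) = normalPart E S x v + normalPart E S x w :=
  map_add _ v w

omit [IsManifold 𝓘(ℝ, E) ∞ X] in
theorem normalPart_sub (S : Set X) (x : X) (v w : TangentSpace 𝓘(ℝ, E) x) :
    normalPart E S x (v - w) = normalPart E S x v - normalPart E S x w :=
  map_sub _ v w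

omit [IsManifold 𝓘(ℝ, E) ∞ X] in
theorem normalPart_smul (S : Set X) (x : X) (c : ℝ) (v : TangentSpace 𝓘(ℝ, E) x) :
    normalPart E S x (c • v) = c • normalPart E S x v :=
  map_smul _ c v

omit [IsManifold 𝓘(ℝ, E) ∞ X] in
theorem normalPart_congr {S : Set X} {x : X} {v w : TangentSpace 𝓘(ℝ, E) x}
    (h : v - w ∈ tangentSpaceOf E S x) : normalPart E S x v = normalPart E S x w := by
  rw [← sub_eq_zero, ← normalPart_sub, normalPart_eq_zero h]

/-- The second fundamental form of `M` can be computed with any vector field that is tangent to `M`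
along a submanifold `S`, in the directions tangent to `S`. -/
theorem normalPart_cov_eq_secondFundamentalForm
    (cov : CovariantDerivative 𝓘(ℝ, E) E (fun x : X => TangentSpace 𝓘(ℝ, E) x))
    {M S : Set X} {d : ℕ} (hM : IsEmbeddedSubmanifold E M d) {x : X} (hx : x ∈ M) (hSM : S ⊆ M)
    {Y : Π y : X, TangentSpace 𝓘(ℝ, E) y} (hY : SmoothNear E x Y)
    (hYM : ∀ᶠ y in 𝓝[S] x, Y y ∈ tangentSpaceOf E M y) (hYx : Y x ∈ tangentSpaceOf E M x)
    {u : TangentSpace 𝓘(ℝ, E) x} (hu : u ∈ tangentSpaceOf E S x) :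
    normalPart E M x (cov Y x u) = secondFundamentalForm E cov M x u (Y x) := by
  have hε := Classical.epsilon_spec (exists_isTangentExtension hM hx hYx)
  refine normalPart_congr ?_
  rw [cov_sub_eq_chartDeriv_sub cov hY.diffAt hε.1.diffAt hε.2.2.symm]
  exact chartDeriv_sub_mem_tangentSpaceOf hM hx hY hε.1 hYM
    (hε.2.1.filter_mono (nhdsWithin_mono x hSM)) hε.2.2.symm hu

theorem IsTangentExtension.normalPart_cov
    (cov : CovariantDerivative 𝓘(ℝ, E) E (fun x : X => TangentSpace 𝓘(ℝ, E) x))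
    {S : Set X} {d : ℕ} (hS : IsEmbeddedSubmanifold E S d) {x : X} (hx : x ∈ S)
    {u v : TangentSpace 𝓘(ℝ, E) x} (hu : u ∈ tangentSpaceOf E S x)
    (hv : v ∈ tangentSpaceOf E S x)
    {Y : Π y : X, TangentSpace 𝓘(ℝ, E) y} (hY : IsTangentExtension E S x v Y) :
    normalPart E S x (cov Y x u) = secondFundamentalForm E cov S x u v := by
  obtain ⟨hY1, hY2, rfl⟩ := hY
  exact normalPart_cov_eq_secondFundamentalForm cov hS hx subset_rfl hY1 hY2 hv hu

end Extension


/-! ### The complex structure in coordinates -/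

section Complex

variable {E : Type*} [NormedAddCommGroup E] [NormedSpace ℂ E]
  {X : Type*} [TopologicalSpace X] [ChartedSpace E X] [IsManifold 𝓘(ℂ, E) ω X]

/-- Multiplication by `i` on the model space. -/
def mulI (E : Type*) [NormedAddCommGroup E] [NormedSpace ℂ E] : E →L[ℝ] E :=
  (Complex.I • ContinuousLinearMap.id ℂ E).restrictScalars ℝ

theorem mulI_mulI (a : E) : mulI E (mulI E a) = -a := by
  change Complex.I • Complex.I • a = -a
  rw [smul_smul, Complex.I_mul_I, neg_one_smul]

omit [IsManifold 𝓘(ℂ, E) ω X] in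
theorem J_J (x : X) (v : TangentSpace 𝓘(ℝ, E) x) : J E x (J E x v) = -v :=
  mulI_mulI (E := E) v

/-- The coordinate changes of the real tangent bundle are those of the complex one. -/
theorem tangentCoordChange_real {x y z : X}
    (h : z ∈ (extChartAt 𝓘(ℝ, E) x).source ∩ (extChartAt 𝓘(ℝ, E) y).source) :
    tangentCoordChange 𝓘(ℝ, E) x y z = (tangentCoordChange 𝓘(ℂ, E) x y z).restrictScalars ℝ := by
  have h1 := hasFDerivWithinAt_tangentCoordChange (I := 𝓘(ℝ, E)) h
  have h2 := (hasFDerivWithinAt_tangentCoordChange (I := 𝓘(ℂ, E)) (x := x) (y := y) (z := z)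
    h).restrictScalars ℝ
  rw [modelWithCornersSelf_coe, range_id, hasFDerivWithinAt_univ] at h1 h2
  exact h1.unique h2

theorem coordMap_eq_tangentCoordChange {x y : X} (hy : y ∈ (chartAt E x).source) :
    (coordMap x y : E →L[ℝ] E) = (tangentCoordChange 𝓘(ℂ, E) y x y).restrictScalars ℝ := by
  rw [← tangentCoordChange_real (by simp [hy])]
  exact TangentBundle.continuousLinearMapAt_trivializationAt_eq_core (𝕜 := ℝ) (I := 𝓘(ℝ, E)) hy

theorem coordMap_J {x y : X} (hy : y ∈ (chartAt E x).source) (v : TangentSpace 𝓘(ℝ, E) y) :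
    coordMap x y (J E y v) = mulI E (coordMap x y v) := by
  have h := fun w : E => congrArg (fun L : E →L[ℝ] E => L w) (coordMap_eq_tangentCoordChange hy)
  refine (h _).trans (Eq.trans ?_ (congrArg (mulI E) (h _)).symm)
  let w : E := v
  exact map_smul (tangentCoordChange 𝓘(ℂ, E) y x y) Complex.I w

theorem coords_JField {x y : X} (hy : y ∈ (chartAt E x).source)
    (Y : Π y : X, TangentSpace 𝓘(ℝ, E) y) :
    coords x (JField E Y) y = mulI E (coords x Y y) :=
  coordMap_J hy (Y y)

theorem eventuallyEq_coords_JField {x y : X} (hy : y ∈ (chartAt E x).source)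
    (Y : Π y : X, TangentSpace 𝓘(ℝ, E) y) :
    coords x (JField E Y) =ᶠ[𝓝 y] fun z => mulI E (coords x Y z) :=
  (eventually_mem_chart_source hy).mono fun _ hz => coords_JField hz Y

theorem SmoothNear.JField {x : X} {Y : Π y : X, TangentSpace 𝓘(ℝ, E) y}
    (hY : SmoothNear E x Y) : SmoothNear E x (JField E Y) := by
  rw [smoothNear_iff_coords] at hY ⊢
  filter_upwards [hY, eventually_mem_chart_source (mem_chart_source E x)] with y hy hys
  exact (((mulI E).contDiff.contMDiff.contMDiffAt (x := coords x Y y)).comp y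
    hy).congr_of_eventuallyEq (eventuallyEq_coords_JField hys Y)

theorem chartDeriv_JField {x : X} {Y : Π y : X, TangentSpace 𝓘(ℝ, E) y}
    (hY : DiffAt E x Y) (u : TangentSpace 𝓘(ℝ, E) x) :
    chartDeriv x (JField E Y) u = J E x (chartDeriv x Y u) := by
  unfold chartDeriv
  rw [mvfderiv_congr (eventuallyEq_coords_JField (mem_chart_source E x) Y)]
  exact mvfderiv_clm_comp (mulI E) (mdifferentiableAt_coords hY) u

/-- A field with constant components is turned by `J` into a field with constant components. -/
theorem eventuallyEq_JField_constField {x : X} (a : TangentSpace 𝓘(ℝ, E) x) :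
    ∀ᶠ y in 𝓝 x, JField E (constField a) y = constField (J E x a) y := by
  filter_upwards [eventually_mem_chart_source (mem_chart_source E x)] with y hy
  refine (ofCoords_coords hy (JField E (constField a))).symm.trans ?_
  refine congrArg ((trivializationAt E (TangentSpace 𝓘(ℝ, E)) x).symmL ℝ y) ?_
  rw [coords_JField hy]
  exact congrArg (mulI E) (coords_ofCoords hy fun _ => (a : E))

omit [IsManifold 𝓘(ℂ, E) ω X] in
theorem mem_holTangent_iff {M : Set X} {x : X} {v : TangentSpace 𝓘(ℝ, E) x} :
    v ∈ holTangent E M x ↔ v ∈ tangentSpaceOf E M x ∧ J E x v ∈ tangentSpaceOf E M x := by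
  refine and_congr_right fun _ => ⟨?_, fun h => ⟨-J E x v, Submodule.neg_mem _ h, ?_⟩⟩
  · rintro ⟨w, hw, rfl⟩
    change J E x (J E x w) ∈ _
    rw [J_J]
    exact Submodule.neg_mem _ hw
  · change J E x (-J E x v) = v
    rw [map_neg, J_J, neg_neg]

theorem cov_constField_J (cov : CovariantDerivative 𝓘(ℝ, E) E (fun x : X => TangentSpace 𝓘(ℝ, E) x))
    {x : X} (a : TangentSpace 𝓘(ℝ, E) x) :
    cov (constField (J E x a)) x = cov (JField E (constField a)) x :=
  (cov.isCovariantDerivativeOnUniv.congr_of_eventuallyEq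
    (smoothNear_constField a).JField.diffAt (smoothNear_constField (J E x a)).diffAt
    univ_mem (eventuallyEq_JField_constField a)).symm

/-- Fields with constant components in a holomorphic chart are holomorphic. -/
theorem mdifferentiableAt_constField {x : X} (a : TangentSpace 𝓘(ℝ, E) x) :
    ∀ᶠ y in 𝓝 x, MDifferentiableAt 𝓘(ℂ, E) 𝓘(ℂ, E).tangent
      (fun z => (⟨z, (constField a z : E)⟩ : TangentBundle 𝓘(ℂ, E) X)) y := by
  filter_upwards [eventually_mem_chart_source (mem_chart_source E x)] with y hy
  let Y : Π y : X, TangentSpace 𝓘(ℂ, E) y := fun z => (constField a z : E)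
  refine ((trivializationAt E (TangentSpace 𝓘(ℂ, E)) x).mdifferentiableAt_section_iff
    𝓘(ℂ, E) Y hy).2 ?_
  have h : (fun z => (trivializationAt E (TangentSpace 𝓘(ℂ, E)) x ⟨z, Y z⟩).2) =ᶠ[𝓝 y]
      fun _ => (a : E) := by
    filter_upwards [eventually_mem_chart_source hy] with z hz
    refine Eq.trans ?_ (coords_ofCoords hz fun _ => (a : E))
    have h1 := congrArg (fun L : E →L[ℝ] E => L (Y z)) (coordMap_eq_tangentCoordChange hz)
    refine Eq.trans ?_ h1.symm
    refine ((trivializationAt E (TangentSpace 𝓘(ℂ, E)) x).continuousLinearMapAt_apply_of_mem ℂ hz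
      (Y z)).symm.trans ?_
    exact congrArg (fun L : E →L[ℂ] E => L (Y z))
      (TangentBundle.continuousLinearMapAt_trivializationAt_eq_core (𝕜 := ℂ) (I := 𝓘(ℂ, E)) hz)
  exact mdifferentiableAt_const.congr_of_eventuallyEq h

/-! ### The Levi form -/

variable [FiniteDimensional ℂ E]

/-- In coordinates, `HM` is the common kernel of `dρ` and `dρ ∘ J`, which has constant rank along `M`
(but in general not off `M`). -/
theorem exists_isHolTangentExtension {M : Set X} {n k : ℕ} (hM : IsCRSubmanifold E M n k) {x : X}
    (hx : x ∈ M) {v : TangentSpace 𝓘(ℝ, E) x} (hv : v ∈ holTangent E M x) :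
    ∃ Y, IsHolTangentExtension E M x v Y := by
  obtain ⟨l, U, ρ, -, hxU, hρ⟩ := hM.submanifold.exists_isDefiningMap hx
  set A := fderiv ℝ (ρ ∘ (extChartAt 𝓘(ℝ, E) x).symm) with hA
  refine exists_extension_of_ker hx (B := fun z => (A z).prod (A z ∘L mulI E)) ?_
    (fun y => holTangent E M y) ?_ ?_ hv
  · filter_upwards [hρ.eventually_contDiffAt_fderiv hxU] with z hz
    exact (ContinuousLinearMap.prodₗᵢ ℝ).contDiff.contDiffAt.comp z
      (hz.prodMk (hz.clm_comp contDiffAt_const))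
  · filter_upwards [self_mem_nhdsWithin, nhdsWithin_le_nhds (hρ.isOpen.mem_nhds hxU),
      nhdsWithin_le_nhds (eventually_mem_chart_source (mem_chart_source E x))] with y hyS hyU hys v
    rw [mem_holTangent_iff, hρ.mem_tangentSpaceOf_iff_coordMap hys hyU hyS,
      hρ.mem_tangentSpaceOf_iff_coordMap hys hyU hyS, coordMap_J hys]
    exact Prod.mk_eq_zero.symm
  · filter_upwards [self_mem_nhdsWithin] with y hyS
    rw [hM.crDim y hyS, hM.crDim x hx]

omit [FiniteDimensional ℂ E] in
theorem IsHolTangentExtension.tangent {M S : Set X} (hS : S ⊆ M) {x : X}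
    {v : TangentSpace 𝓘(ℝ, E) x} {Y : Π y : X, TangentSpace 𝓘(ℝ, E) y}
    (hY : IsHolTangentExtension E M x v Y) :
    (∀ᶠ y in 𝓝[S] x, Y y ∈ tangentSpaceOf E M y) ∧
      ∀ᶠ y in 𝓝[S] x, JField E Y y ∈ tangentSpaceOf E M y :=
  eventually_and.1 <| (hY.2.1.filter_mono (nhdsWithin_mono x hS)).mono fun _ hy =>
    mem_holTangent_iff.1 hy

variable [RiemannianBundle (fun x : X => TangentSpace 𝓘(ℝ, E) x)]

theorem leviBracket_eq_chartDeriv (M : Set X) {x : X} {Y : Π y : X, TangentSpace 𝓘(ℝ, E) y}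
    (hY : SmoothNear E x Y) :
    leviBracket E M x Y = normalPart E M x
      (chartDeriv x Y (Y x) + chartDeriv x (JField E Y) (J E x (Y x))) := by
  have h : J E x (VectorField.mlieBracket 𝓘(ℝ, E) (JField E Y) Y x) =
      chartDeriv x Y (Y x) + chartDeriv x (JField E Y) (J E x (Y x)) := by
    rw [mlieBracket_eq_chartDeriv hY.JField.diffAt hY.diffAt, map_sub,
      chartDeriv_JField hY.diffAt, chartDeriv_JField hY.diffAt, J_J, sub_neg_eq_add, add_comm]
    rfl
  unfold leviBracket
  rw [h]

/-- The expression `D_v Y + D_{Jv} Z`, for `D` the flat connection of a holomorphic chart, has the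
same normal part for all fields `Y` and `Z` that extend `v` and `Jv` and are tangent to `M` along a
subset `S` whose tangent space contains `v` and `Jv`. -/
theorem IsHolTangentExtension.leviBracket_eq {M S : Set X} {n k : ℕ} (hM : IsCRSubmanifold E M n k)
    {x : X} (hx : x ∈ M) (hSM : S ⊆ M) {v : TangentSpace 𝓘(ℝ, E) x}
    (hvS : v ∈ tangentSpaceOf E S x) (hJvS : J E x v ∈ tangentSpaceOf E S x)
    {W : Π y : X, TangentSpace 𝓘(ℝ, E) y} (hW : IsHolTangentExtension E M x v W)
    {Y Z : Π y : X, TangentSpace 𝓘(ℝ, E) y} (hY : SmoothNear E x Y) (hZ : SmoothNear E x Z)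
    (hYM : ∀ᶠ y in 𝓝[S] x, Y y ∈ tangentSpaceOf E M y)
    (hZM : ∀ᶠ y in 𝓝[S] x, Z y ∈ tangentSpaceOf E M y) (hYx : Y x = v) (hZx : Z x = J E x v) :
    leviBracket E M x W = normalPart E M x (chartDeriv x Y v + chartDeriv x Z (J E x v)) := by
  obtain ⟨hWM, hJWM⟩ := hW.tangent hSM
  have hWx := hW.2.2
  rw [leviBracket_eq_chartDeriv M hW.1, hWx]
  refine normalPart_congr ?_
  rw [add_sub_add_comm]
  refine Submodule.add_mem _ ?_ ?_
  · exact chartDeriv_sub_mem_tangentSpaceOf hM.submanifold hx hW.1 hY hWM hYM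
      (hWx.trans hYx.symm) hvS
  · refine chartDeriv_sub_mem_tangentSpaceOf hM.submanifold hx hW.1.JField hZ hJWM hZM ?_ hJvS
    rw [hZx, ← hWx]
    rfl

theorem leviForm_eq_chartDeriv {M S : Set X} {n k : ℕ} (hM : IsCRSubmanifold E M n k)
    {x : X} (hx : x ∈ M) (hSM : S ⊆ M) {v : TangentSpace 𝓘(ℝ, E) x} (hv : v ∈ holTangent E M x)
    (hvS : v ∈ tangentSpaceOf E S x) (hJvS : J E x v ∈ tangentSpaceOf E S x)
    {Y Z : Π y : X, TangentSpace 𝓘(ℝ, E) y} (hY : SmoothNear E x Y) (hZ : SmoothNear E x Z)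
    (hYM : ∀ᶠ y in 𝓝[S] x, Y y ∈ tangentSpaceOf E M y)
    (hZM : ∀ᶠ y in 𝓝[S] x, Z y ∈ tangentSpaceOf E M y) (hYx : Y x = v) (hZx : Z x = J E x v) :
    leviForm E M x v = normalPart E M x (chartDeriv x Y v + chartDeriv x Z (J E x v)) :=
  IsHolTangentExtension.leviBracket_eq hM hx hSM hvS hJvS
    (Classical.epsilon_spec (exists_isHolTangentExtension hM hx hv)) hY hZ hYM hZM hYx hZx

theorem IsHolTangentExtension.leviBracket_eq_leviForm {M : Set X} {n k : ℕ}
    (hM : IsCRSubmanifold E M n k) {x : X} (hx : x ∈ M) {v : TangentSpace 𝓘(ℝ, E) x}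
    (hv : v ∈ holTangent E M x)
    {W : Π y : X, TangentSpace 𝓘(ℝ, E) y} (hW : IsHolTangentExtension E M x v W) :
    leviBracket E M x W = leviForm E M x v := by
  obtain ⟨h1, h2⟩ := mem_holTangent_iff.1 hv
  obtain ⟨Y, hY, hYM, hYx⟩ := exists_isTangentExtension hM.submanifold hx h1
  obtain ⟨Z, hZ, hZM, hZx⟩ := exists_isTangentExtension hM.submanifold hx h2
  rw [leviForm_eq_chartDeriv hM hx subset_rfl hv h1 h2 hY hZ hYM hZM hYx hZx]
  exact hW.leviBracket_eq hM hx subset_rfl h1 h2 hY hZ hYM hZM hYx hZx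

/-- The Levi form is the sum of the values of the second fundamental form on `v` and `Jv`, for each
connection whose Christoffel tensor `A` in holomorphic coordinates satisfies
`A(a, a) + A(Ja, Ja) = 0`. -/
theorem leviForm_eq_secondFundamentalForm {M : Set X} {n k : ℕ} (hM : IsCRSubmanifold E M n k)
    {x : X} (hx : x ∈ M) {v : TangentSpace 𝓘(ℝ, E) x} (hv : v ∈ holTangent E M x)
    {cov : CovariantDerivative 𝓘(ℝ, E) E (fun x : X => TangentSpace 𝓘(ℝ, E) x)}
    (hcov : cov (constField v) x v + cov (constField (J E x v)) x (J E x v) = 0) :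
    leviForm E M x v = secondFundamentalForm E cov M x v v +
      secondFundamentalForm E cov M x (J E x v) (J E x v) := by
  obtain ⟨h1, h2⟩ := mem_holTangent_iff.1 hv
  obtain ⟨Y, hY⟩ := exists_isTangentExtension hM.submanifold hx h1
  obtain ⟨Z, hZ⟩ := exists_isTangentExtension hM.submanifold hx h2
  rw [leviForm_eq_chartDeriv hM hx subset_rfl hv h1 h2 hY.1 hZ.1 hY.2.1 hZ.2.1 hY.2.2 hZ.2.2,
    ← hY.normalPart_cov cov hM.submanifold hx h1 h1,
    ← hZ.normalPart_cov cov hM.submanifold hx h2 h2, ← normalPart_add,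
    cov_eq_chartDeriv_add cov hY.1.diffAt, cov_eq_chartDeriv_add cov hZ.1.diffAt, hY.2.2, hZ.2.2]
  refine congrArg (normalPart E M x) ?_
  simp only [add_apply]
  rw [add_add_add_comm, hcov, add_zero]

omit [FiniteDimensional ℂ E] in
theorem IsHermitianConnection.cov_constField_add
    {cov : CovariantDerivative 𝓘(ℝ, E) E (fun x : X => TangentSpace 𝓘(ℝ, E) x)}
    (h : IsHermitianConnection E cov) {x : X} (a : TangentSpace 𝓘(ℝ, E) x) :
    cov (constField a) x a + cov (constField (J E x a)) x (J E x a) = 0 := by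
  have h1 : cov (constField a) x (J E x a) = J E x (cov (constField a) x a) :=
    h.holomorphic x (fun z => (constField a z : E)) a (mdifferentiableAt_constField a)
  rw [cov_constField_J, h.parallel x _ _ (smoothNear_constField a).diffAt, h1, J_J, add_neg_cancel]

/-- With `A` the Christoffel tensor in holomorphic coordinates, the Koszul formula reduces the claim
`A(a, a) + A(Ja, Ja) = 0` to the closedness of the fundamental form, evaluated on the constant
fields `a`, `Ja`, `c`. -/
theorem IsLeviCivita.cov_constField_add (hK : IsKaehler E X)
    {cov : CovariantDerivative 𝓘(ℝ, E) E (fun x : X => TangentSpace 𝓘(ℝ, E) x)}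
    (h : IsLeviCivita E cov) {x : X} (a : TangentSpace 𝓘(ℝ, E) x) :
    cov (constField a) x a + cov (constField (J E x a)) x (J E x a) = 0 := by
  set b := J E x a with hb
  have hsm := fun u : TangentSpace 𝓘(ℝ, E) x => smoothNear_constField u
  have hsymm : ∀ u w : TangentSpace 𝓘(ℝ, E) x, cov (constField u) x w = cov (constField w) x u := by
    intro u w
    have h1 := cov.torsion_eq_zero_iff.1 h.2 (hsm w).diffAt (hsm u).diffAt
    rw [mlieBracket_constField, constField_self, constField_self] at h1
    exact sub_eq_zero.1 h1
  let G : TangentSpace 𝓘(ℝ, E) x → TangentSpace 𝓘(ℝ, E) x → TangentSpace 𝓘(ℝ, E) x → ℝ :=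
    fun p q r => mvfderiv 𝓘(ℝ, E) (fun y => (inner ℝ (constField q y) (constField r y) : ℝ)) x p
  have hG : ∀ p q r, G p q r = inner ℝ (cov (constField q) x p) r +
      inner ℝ q (cov (constField r) x p) := by
    intro p q r
    have h1 := h.1 x (constField q) (constField r) p (hsm q).diffAt (hsm r).diffAt
    rwa [constField_self, constField_self] at h1
  have hJ := eventuallyEq_JField_constField a
  have hneg : ∀ y : X, JField E (JField E (constField a)) y = -constField a y := fun y => J_J y _
  have hbb : ∀ p, G p b b = G p a a := by
    intro p
    refine congrArg (fun L : TangentSpace 𝓘(ℝ, E) x →L[ℝ] ℝ => L p) (mvfderiv_congr ?_)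
    filter_upwards [hJ] with y hy
    rw [← hy]
    exact hK.1 y _ _
  have hclosed : ∀ c, -G a a c - G b b c + G c a a = 0 := by
    intro c
    have h1 := hK.2 x (constField a) (constField b) (constField c) (hsm a) (hsm b) (hsm c)
    have hz : ∀ Z : Π y : X, TangentSpace 𝓘(ℝ, E) y,
        ∀ p q : TangentSpace 𝓘(ℝ, E) x,
        fundForm E (VectorField.mlieBracket 𝓘(ℝ, E) (constField p) (constField q)) Z x = 0 := by
      intro Z p q
      unfold fundForm
      rw [mlieBracket_constField p q, map_zero, inner_zero_left]
    have e1 : fundForm E (constField b) (constField c) =ᶠ[𝓝 x]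
        fun y => -(inner ℝ (constField a y) (constField c y) : ℝ) := by
      filter_upwards [hJ] with y hy
      unfold fundForm
      rw [← hy, ← inner_neg_left]
      exact congrArg (fun w => (inner ℝ w (constField c y) : ℝ)) (hneg y)
    have e2 : fundForm E (constField a) (constField c) =ᶠ[𝓝 x]
        fun y => (inner ℝ (constField b y) (constField c y) : ℝ) := by
      filter_upwards [hJ] with y hy
      rw [← hy]
      rfl
    have e3 : fundForm E (constField a) (constField b) =ᶠ[𝓝 x]
        fun y => (inner ℝ (constField a y) (constField a y) : ℝ) := by
      filter_upwards [hJ] with y hy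
      rw [← hK.1 y, show J E y (constField a y) = constField b y from hy]
      unfold fundForm
      rw [show J E y (constField a y) = constField b y from hy]
    rw [hz, hz, hz, mvfderiv_congr e1, mvfderiv_congr e2, mvfderiv_congr e3, mvfderiv_fun_neg,
      constField_self, constField_self, constField_self] at h1
    rw [sub_zero, add_zero, sub_zero] at h1
    exact h1
  have hKoszul : ∀ p c, (inner ℝ (cov (constField p) x p) c : ℝ) = G p p c - G c p p / 2 := by
    intro p c
    rw [hG, hG, hsymm c p, real_inner_comm p]
    ring
  have hall : ∀ c, (inner ℝ (cov (constField a) x a + cov (constField b) x b) c : ℝ) = 0 := by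
    intro c
    rw [inner_add_left, hKoszul, hKoszul, hbb]
    linarith [hclosed c]
  exact inner_self_eq_zero.1 (hall _)

end Complex


/-! ### The mean curvature vector -/

section MeanCurvature

variable {E : Type*} [NormedAddCommGroup E] [NormedSpace ℝ E]
  {X : Type*} [TopologicalSpace X] [ChartedSpace E X]

theorem tangentSpaceOf_mono {S M : Set X} (h : S ⊆ M) (x : X) :
    tangentSpaceOf E S x ≤ tangentSpaceOf E M x :=
  fun _ hv f hf h0 => hv f hf (h0.filter_mono (nhdsWithin_mono x h))

variable [IsManifold 𝓘(ℝ, E) ∞ X]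

theorem SmoothNear.add {x : X} {Y Z : Π y : X, TangentSpace 𝓘(ℝ, E) y}
    (hY : SmoothNear E x Y) (hZ : SmoothNear E x Z) : SmoothNear E x (Y + Z) := by
  rw [smoothNear_iff_coords] at *
  filter_upwards [hY, hZ] with y hy hz
  rw [coords_add]
  exact hy.add hz

theorem SmoothNear.const_smul {x : X} {Y : Π y : X, TangentSpace 𝓘(ℝ, E) y}
    (hY : SmoothNear E x Y) (c : ℝ) : SmoothNear E x ((fun _ : X => c) • Y) := by
  rw [smoothNear_iff_coords] at *
  filter_upwards [hY] with y hy
  rw [coords_smul]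
  exact ((c • ContinuousLinearMap.id ℝ E).contDiff.contMDiff.contMDiffAt
    (x := coords x Y y)).comp y hy

theorem IsTangentExtension.add {S : Set X} {x : X} {v w : TangentSpace 𝓘(ℝ, E) x}
    {Y Z : Π y : X, TangentSpace 𝓘(ℝ, E) y} (hY : IsTangentExtension E S x v Y)
    (hZ : IsTangentExtension E S x w Z) : IsTangentExtension E S x (v + w) (Y + Z) := by
  refine ⟨hY.1.add hZ.1, ?_, congrArg₂ (· + ·) hY.2.2 hZ.2.2⟩
  filter_upwards [hY.2.1, hZ.2.1] with y hy hz
  exact Submodule.add_mem _ hy hz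

theorem IsTangentExtension.const_smul {S : Set X} {x : X} {v : TangentSpace 𝓘(ℝ, E) x}
    {Y : Π y : X, TangentSpace 𝓘(ℝ, E) y} (hY : IsTangentExtension E S x v Y) (c : ℝ) :
    IsTangentExtension E S x (c • v) ((fun _ : X => c) • Y) := by
  refine ⟨hY.1.const_smul c, ?_, congrArg (c • ·) hY.2.2⟩
  filter_upwards [hY.2.1] with y hy
  exact Submodule.smul_mem _ c hy

variable [FiniteDimensional ℝ E] [RiemannianBundle (fun x : X => TangentSpace 𝓘(ℝ, E) x)]

/-- The second fundamental form of a submanifold, as a bilinear map on its tangent space. -/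
def secondFundamentalFormₗ
    (cov : CovariantDerivative 𝓘(ℝ, E) E (fun x : X => TangentSpace 𝓘(ℝ, E) x))
    {S : Set X} {d : ℕ} (hS : IsEmbeddedSubmanifold E S d) {x : X} (hx : x ∈ S) :
    tangentSpaceOf E S x →ₗ[ℝ] tangentSpaceOf E S x →ₗ[ℝ] TangentSpace 𝓘(ℝ, E) x :=
  LinearMap.mk₂ ℝ (fun u v => secondFundamentalForm E cov S x u v)
    (fun u u' v => by
      simp only [secondFundamentalForm, Submodule.coe_add, map_add, normalPart_add])
    (fun c u v => by
      simp only [secondFundamentalForm, Submodule.coe_smul, map_smul, normalPart_smul])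
    (fun u v v' => by
      obtain ⟨Y, hY⟩ := exists_isTangentExtension hS hx v.2
      obtain ⟨Z, hZ⟩ := exists_isTangentExtension hS hx v'.2
      rw [← hY.normalPart_cov cov hS hx u.2 v.2, ← hZ.normalPart_cov cov hS hx u.2 v'.2,
        ← (hY.add hZ).normalPart_cov cov hS hx u.2 (v + v').2, ← normalPart_add,
        cov.isCovariantDerivativeOnUniv.add hY.1.diffAt hZ.1.diffAt]
      rfl)
    (fun c u v => by
      obtain ⟨Y, hY⟩ := exists_isTangentExtension hS hx v.2
      rw [← hY.normalPart_cov cov hS hx u.2 v.2,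
        ← (hY.const_smul c).normalPart_cov cov hS hx u.2 (c • v).2, ← normalPart_smul,
        cov.isCovariantDerivativeOnUniv.leibniz hY.1.diffAt mdifferentiableAt_const,
        mvfderiv_const]
      simp)

/-- The trace of the second fundamental form may be taken over any orthonormal basis. -/
theorem finrank_smul_meanCurvatureVector
    (cov : CovariantDerivative 𝓘(ℝ, E) E (fun x : X => TangentSpace 𝓘(ℝ, E) x))
    {S : Set X} {d : ℕ} (hS : IsEmbeddedSubmanifold E S d) (hd : d ≠ 0) {x : X} (hx : x ∈ S)
    {ι : Type*} [Fintype ι] (b : OrthonormalBasis ι ℝ (tangentSpaceOf E S x)) :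
    (d : ℝ) • meanCurvatureVector E cov S x = ∑ i, secondFundamentalForm E cov S x (b i) (b i) := by
  have h := congrArg (TensorProduct.lift (secondFundamentalFormₗ cov hS hx))
    ((InnerProductSpace.canonicalCovariantTensor_eq_sum _ b).symm.trans
      (InnerProductSpace.canonicalCovariantTensor_eq_sum _
        (stdOrthonormalBasis ℝ (tangentSpaceOf E S x))))
  simp only [map_sum, TensorProduct.lift.tmul] at h
  refine Eq.trans ?_ h.symm
  have hd' : (d : ℝ) * (finrank ℝ (tangentSpaceOf E S x) : ℝ)⁻¹ = 1 := by
    rw [hS.finrank_tangentSpaceOf hx, mul_inv_cancel₀ (Nat.cast_ne_zero.2 hd)]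
  unfold meanCurvatureVector
  rw [smul_smul, hd', one_smul]
  rfl

end MeanCurvature

section Complex

variable {E : Type*} [NormedAddCommGroup E] [NormedSpace ℂ E]
  {X : Type*} [TopologicalSpace X] [ChartedSpace E X] [IsManifold 𝓘(ℂ, E) ω X]
  [FiniteDimensional ℂ E] [RiemannianBundle (fun x : X => TangentSpace 𝓘(ℝ, E) x)]

/-- The Levi form of `M` at `v` is determined by the second fundamental form of each submanifold of
`M` that is tangent to `v` and `Jv`. -/
theorem leviForm_eq_normalPart_secondFundamentalForm {M S : Set X} {n k d : ℕ}
    (hM : IsCRSubmanifold E M n k) (hS : IsEmbeddedSubmanifold E S d) (hSM : S ⊆ M)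
    {x : X} (hx : x ∈ S) {v : TangentSpace 𝓘(ℝ, E) x}
    (hv : v ∈ tangentSpaceOf E S x) (hJv : J E x v ∈ tangentSpaceOf E S x)
    {cov : CovariantDerivative 𝓘(ℝ, E) E (fun x : X => TangentSpace 𝓘(ℝ, E) x)}
    (hcov : cov (constField v) x v + cov (constField (J E x v)) x (J E x v) = 0) :
    leviForm E M x v = normalPart E M x (secondFundamentalForm E cov S x v v +
      secondFundamentalForm E cov S x (J E x v) (J E x v)) := by
  have hle := tangentSpaceOf_mono (E := E) hSM
  obtain ⟨Y, hY⟩ := exists_isTangentExtension hS hx hv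
  obtain ⟨Z, hZ⟩ := exists_isTangentExtension hS hx hJv
  rw [leviForm_eq_chartDeriv hM (hSM hx) hSM (mem_holTangent_iff.2 ⟨hle x hv, hle x hJv⟩) hv hJv
    hY.1 hZ.1 (hY.2.1.mono fun y hy => hle y hy) (hZ.2.1.mono fun y hy => hle y hy)
    hY.2.2 hZ.2.2,
    ← hY.normalPart_cov cov hS hx hv hv, ← hZ.normalPart_cov cov hS hx hJv hJv, ← normalPart_add,
    cov_eq_chartDeriv_add cov hY.1.diffAt, cov_eq_chartDeriv_add cov hZ.1.diffAt, hY.2.2, hZ.2.2]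
  simp only [add_apply]
  rw [add_add_add_comm, hcov, add_zero]
  -- The projections differ by a vector tangent to `S`.
  refine normalPart_congr (hle x ?_)
  set w := chartDeriv x Y v + chartDeriv x Z (J E x v)
  have h := Submodule.starProjection_orthogonal_val (K := tangentSpaceOf E S x) w
  have h' : w - normalPart E S x w = (tangentSpaceOf E S x).starProjection w := by
    unfold normalPart
    rw [h, sub_sub_cancel]
  rw [h']
  exact Submodule.starProjection_apply_mem _ w

omit [IsManifold 𝓘(ℂ, E) ω X] [FiniteDimensional ℂ E] in
theorem IsHermitian.inner_J_self (h : IsHermitian E X) {x : X} (v : TangentSpace 𝓘(ℝ, E) x) :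
    (inner ℝ v (J E x v) : ℝ) = 0 := by
  have h1 := h x v (J E x v)
  rw [J_J, inner_neg_right, real_inner_comm] at h1
  linarith

omit [IsManifold 𝓘(ℂ, E) ω X] [FiniteDimensional ℂ E] in
theorem IsHermitian.orthonormal (h : IsHermitian E X) {x : X} {v : TangentSpace 𝓘(ℝ, E) x}
    (hv : ‖v‖ = 1) : Orthonormal ℝ ![v, J E x v] := by
  have hJ : ‖J E x v‖ = 1 := by
    rw [← hv, ← sq_eq_sq₀ (norm_nonneg _) (norm_nonneg _), ← real_inner_self_eq_norm_sq,
      ← real_inner_self_eq_norm_sq, h]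
  rw [orthonormal_vecCons_iff]
  refine ⟨hv, fun i => ?_, ?_⟩
  · fin_cases i
    exact h.inner_J_self v
  · rw [orthonormal_vecCons_iff]
    exact ⟨hJ, fun i => i.elim0, ⟨fun i => i.elim0, fun i => i.elim0⟩⟩

theorem two_smul_meanCurvatureVector (h : IsHermitian E X)
    (cov : CovariantDerivative 𝓘(ℝ, E) E (fun x : X => TangentSpace 𝓘(ℝ, E) x))
    {S : Set X} (hS : IsEmbeddedSubmanifold E S 2) {x : X} (hx : x ∈ S)
    {v : TangentSpace 𝓘(ℝ, E) x} (hv1 : ‖v‖ = 1)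
    (hv : v ∈ tangentSpaceOf E S x) (hJv : J E x v ∈ tangentSpaceOf E S x) :
    (2 : ℝ) • meanCurvatureVector E cov S x = secondFundamentalForm E cov S x v v +
      secondFundamentalForm E cov S x (J E x v) (J E x v) := by
  let w : Fin 2 → tangentSpaceOf E S x := ![⟨v, hv⟩, ⟨J E x v, hJv⟩]
  have hw : Orthonormal ℝ w := by
    have h1 := h.orthonormal hv1
    have h2 : ![v, J E x v] = (tangentSpaceOf E S x).subtypeₗᵢ ∘ w := by
      funext i
      fin_cases i <;> rfl
    rw [h2] at h1
    exact (LinearIsometry.orthonormal_comp_iff _).1 h1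
  have hcard : Fintype.card (Fin 2) = finrank ℝ (tangentSpaceOf E S x) := by
    rw [hS.finrank_tangentSpaceOf hx, Fintype.card_fin]
  have hcoe := coe_basisOfOrthonormalOfCardEqFinrank hw hcard
  let b := (basisOfOrthonormalOfCardEqFinrank hw hcard).toOrthonormalBasis (by rwa [hcoe])
  have hb : ∀ i, b i = w i := fun i => by
    rw [Basis.coe_toOrthonormalBasis, hcoe]
  have h3 := finrank_smul_meanCurvatureVector cov hS two_ne_zero hx b
  rw [Fin.sum_univ_two, hb, hb] at h3
  exact_mod_cast h3

end Complex


/-! ### Submanifolds of vector spaces -/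

section VectorSpace

variable {E : Type*} [NormedAddCommGroup E] [NormedSpace ℝ E]
  {F : Type*} [NormedAddCommGroup F] [NormedSpace ℝ F]

theorem mvfderiv_eq_fderiv (f : E → F) (x : E) (v : TangentSpace 𝓘(ℝ, E) x) :
    mvfderiv 𝓘(ℝ, E) f x v = fderiv ℝ f x v := by
  unfold mvfderiv
  rw [mfderiv_eq_fderiv]
  rfl

theorem coordMap_vectorSpace (x y : E) (v : TangentSpace 𝓘(ℝ, E) y) : coordMap x y v = v := by
  unfold coordMap
  rw [TangentBundle.continuousLinearMapAt_model_space]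
  rfl

theorem chartDeriv_eq_flatConnection (x : E) (Y : Π y : E, TangentSpace 𝓘(ℝ, E) y) :
    chartDeriv x Y = flatConnection E Y x := by
  have h : coords x Y = fun y => (Y y : E) := funext fun y => coordMap_vectorSpace x y (Y y)
  ext u
  unfold chartDeriv
  rw [h]
  exact mvfderiv_eq_fderiv (fun y => (Y y : E)) x u

theorem smoothNear_iff_contDiffAt {x : E} {Y : Π y : E, TangentSpace 𝓘(ℝ, E) y} :
    SmoothNear E x Y ↔ ∀ᶠ y in 𝓝 x, ContDiffAt ℝ ∞ (fun z => (Y z : E)) y := by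
  have h : coords x Y = fun y => (Y y : E) := funext fun y => coordMap_vectorSpace x y (Y y)
  rw [smoothNear_iff_coords, h]
  exact eventually_congr (.of_forall fun y => contMDiffAt_iff_contDiffAt)

theorem flatConnection_constField [FiniteDimensional ℝ E] {x : E} (a : TangentSpace 𝓘(ℝ, E) x) :
    flatConnection E (constField a) x = 0 := by
  rw [← chartDeriv_eq_flatConnection, chartDeriv_constField]

/-- The velocity of a curve in `S` is tangent to `S`. -/
theorem deriv_mem_tangentSpaceOf {S : Set E} {γ : ℝ → E} (hγ : DifferentiableAt ℝ γ 0)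
    (hS : ∀ᶠ t in 𝓝 (0 : ℝ), γ t ∈ S) :
    (deriv γ 0 : TangentSpace 𝓘(ℝ, E) (γ 0)) ∈ tangentSpaceOf E S (γ 0) := by
  intro f hf h0
  have hfd : DifferentiableAt ℝ f (γ 0) := (hf.mdifferentiableAt (by simp)).differentiableAt
  have h1 : Tendsto γ (𝓝 0) (𝓝[S] (γ 0)) :=
    tendsto_nhdsWithin_iff.2 ⟨hγ.continuousAt.tendsto, hS⟩
  have h2 : f ∘ γ =ᶠ[𝓝 0] fun _ => (0 : ℝ) := h1.eventually h0
  have h3 := (hfd.hasFDerivAt.comp_hasDerivAt (0 : ℝ) hγ.hasDerivAt).deriv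
  rw [h2.deriv_eq, deriv_const] at h3
  rw [mvfderiv_eq_fderiv]
  exact h3.symm

/-- Surjectivity is an open condition on linear maps. -/
theorem eventually_surjective [FiniteDimensional ℝ F] {A : E → E →L[ℝ] F} {x : E}
    (hA : ContinuousAt A x) (hs : Function.Surjective (A x)) :
    ∀ᶠ y in 𝓝 x, Function.Surjective (A y) := by
  obtain ⟨r, hr⟩ := (A x).toLinearMap.exists_rightInverse_of_surjective
    (LinearMap.range_eq_top.2 hs)
  let R : F →L[ℝ] E := LinearMap.toContinuousLinearMap r
  have hc : ContinuousAt (fun y => A y ∘L R) x := hA.clm_comp continuousAt_const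
  have h1 : A x ∘L R = 1 := by
    ext g
    exact LinearMap.congr_fun hr g
  have hmem : {c : F →L[ℝ] F | IsUnit c} ∈ 𝓝 (A x ∘L R) :=
    (Units.isOpen (R := F →L[ℝ] F)).mem_nhds (h1 ▸ isUnit_one)
  filter_upwards [hc hmem] with y hy g
  refine ⟨R (Ring.inverse (A y ∘L R) g), ?_⟩
  change ((A y ∘L R) * Ring.inverse (A y ∘L R)) g = g
  rw [Ring.mul_inverse_cancel _ hy]
  rfl

/-- Near `x`, a submanifold `M` and an affine subspace `x + K` transverse to `M` at `x` intersect in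
a submanifold, whose tangent space at `x` is the intersection of those of `M` and `K`. -/
theorem IsEmbeddedSubmanifold.exists_inter_affine [FiniteDimensional ℝ E] {M : Set E} {d : ℕ}
    (hM : IsEmbeddedSubmanifold E M d) {x : E} (hx : x ∈ M)
    {K : Submodule ℝ (TangentSpace 𝓘(ℝ, E) x)} (hK : tangentSpaceOf E M x ⊔ K = ⊤) :
    ∃ U : Set E, IsOpen U ∧ x ∈ U ∧
      IsEmbeddedSubmanifold E ({y ∈ M | (y - x : E) ∈ K} ∩ U)
        (finrank ℝ ↥(tangentSpaceOf E M x ⊓ K)) ∧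
      tangentSpaceOf E ({y ∈ M | (y - x : E) ∈ K} ∩ U) x = tangentSpaceOf E M x ⊓ K := by
  obtain ⟨l, U, ρ, hl, hxU, hρ⟩ := hM.exists_isDefiningMap hx
  -- With `q` linear of kernel `K`, the intersection is defined by `(ρ y, q (y - x))`.
  let K' : Submodule ℝ E := K
  let q₀ : E →ₗ[ℝ] (Fin (finrank ℝ (E ⧸ K')) → ℝ) :=
    (finBasis ℝ (E ⧸ K')).equivFun.toLinearMap ∘ₗ K'.mkQ
  let q : E →L[ℝ] (Fin (finrank ℝ (E ⧸ K')) → ℝ) := LinearMap.toContinuousLinearMap q₀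
  have hq : ∀ w : E, q w = 0 ↔ w ∈ K' := fun w => by
    change (finBasis ℝ (E ⧸ K')).equivFun (K'.mkQ w) = 0 ↔ _
    rw [LinearEquiv.map_eq_zero_iff, Submodule.mkQ_apply, Submodule.Quotient.mk_eq_zero]
  have hqs : Function.Surjective q :=
    (finBasis ℝ (E ⧸ K')).equivFun.surjective.comp K'.mkQ_surjective
  have hρd : ∀ y ∈ U, ContDiffAt ℝ ∞ ρ y := fun y hy => (hρ.contMDiffAt hy).contDiffAt
  let σ : E → (Fin l → ℝ) × (Fin (finrank ℝ (E ⧸ K')) → ℝ) := fun y => (ρ y, q (y - x))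
  have hσ : ∀ y ∈ U, ContDiffAt ℝ ∞ σ y := fun y hy =>
    (hρd y hy).prodMk (q.contDiff.contDiffAt.comp y (contDiffAt_id.sub contDiffAt_const))
  have hσ' : ∀ y ∈ U, ∀ w : E, fderiv ℝ σ y w = (fderiv ℝ ρ y w, q w) := fun y hy w => by
    have h1 : HasFDerivAt (fun y => q (y - x)) q y :=
      q.hasFDerivAt.comp y ((hasFDerivAt_id y).sub_const x)
    have h2 : HasFDerivAt σ ((fderiv ℝ ρ y).prod q) y :=
      ((hρd y hy).differentiableAt (by simp)).hasFDerivAt.prodMk h1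
    rw [h2.fderiv]
    rfl
  have hker : ∀ w : E, fderiv ℝ ρ x w = 0 ↔
      w ∈ (tangentSpaceOf E M x : Submodule ℝ (TangentSpace 𝓘(ℝ, E) x)) := fun w => by
    rw [← mvfderiv_eq_fderiv ρ x w]
    exact (hρ.mem_tangentSpaceOf_iff hxU hx).symm
  have hsx : Function.Surjective (fderiv ℝ σ x) := by
    -- Preimages `u` of `a` under `dρ` and `w` of `b` under `q` differ by `t + c` with `t` in `T_x M`
    -- and `c` in `K`, so that `u + t = w - c` is a preimage of `(a, b)`.
    rintro ⟨a, b⟩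
    obtain ⟨u, hu⟩ := hρ.surjective x hxU hx a
    rw [mvfderiv_eq_fderiv] at hu
    obtain ⟨w, hw⟩ := hqs b
    let u' : E := u
    have hmem : (show TangentSpace 𝓘(ℝ, E) x from (w - u' : E)) ∈ tangentSpaceOf E M x ⊔ K := by
      rw [hK]
      exact Submodule.mem_top
    obtain ⟨t, ht, c, hc, htc⟩ := Submodule.mem_sup.1 hmem
    let t' : E := t
    let c' : E := c
    have htc' : t' + c' = w - u' := htc
    refine ⟨u' + t', ?_⟩
    rw [hσ' x hxU]
    refine Prod.ext ?_ ?_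
    · change fderiv ℝ ρ x (u' + t') = a
      rw [map_add, (hker t').2 ht, add_zero]
      exact hu
    · change q (u' + t') = b
      have h1 : u' + t' = w - c' := by
        rw [eq_sub_iff_add_eq, add_assoc, htc', add_sub_cancel]
      rw [h1, map_sub, hw, (hq c').2 hc, sub_zero]
  have hcont : ContinuousAt (fderiv ℝ σ) x :=
    ((hσ x hxU).fderiv_right (m := ∞) (by simp)).continuousAt
  obtain ⟨V, hVs, hVo, hxV⟩ := mem_nhds_iff.1 (eventually_surjective hcont hsx)
  have hdef : IsDefiningMap (E := E) ({y ∈ M | (y - x : E) ∈ K} ∩ (U ∩ V)) (U ∩ V) σ := by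
    refine ⟨hρ.isOpen.inter hVo, fun y hy => (hσ y hy.1).contMDiffAt.contMDiffWithinAt,
      fun y hy => ?_, fun y hy _ a => ?_⟩
    · refine (and_iff_left hy).trans ?_
      refine (and_congr (hρ.mem_iff y hy.1) (hq (y - x)).symm).trans ?_
      exact Prod.mk_eq_zero.symm
    · obtain ⟨w, hw⟩ := hVs hy.2 a
      exact ⟨w, (mvfderiv_eq_fderiv σ y w).trans hw⟩
  have hxS : x ∈ {y ∈ M | (y - x : E) ∈ K} ∩ (U ∩ V) := by
    refine ⟨⟨hx, ?_⟩, hxU, hxV⟩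
    rw [sub_self]
    exact K.zero_mem
  have hT : tangentSpaceOf E ({y ∈ M | (y - x : E) ∈ K} ∩ (U ∩ V)) x =
      tangentSpaceOf E M x ⊓ K := by
    ext w
    rw [hdef.mem_tangentSpaceOf_iff ⟨hxU, hxV⟩ hxS, mvfderiv_eq_fderiv]
    refine Eq.congr_left (hσ' x hxU w) |>.trans ?_
    exact Prod.mk_eq_zero.trans (and_congr (hker w) (hq w))
  refine ⟨U ∩ V, hρ.isOpen.inter hVo, ⟨hxU, hxV⟩, ?_, hT⟩
  refine isEmbeddedSubmanifold_of_isDefiningMap ?_ fun y hy => ⟨U ∩ V, σ, hy.2, hdef⟩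
  rw [← hT]
  exact hdef.finrank_tangentSpaceOf ⟨hxU, hxV⟩ hxS

end VectorSpace

/-! ### Surfaces in complex Euclidean space -/

section Slice

variable {m : ℕ}

theorem isHermitian_Cn : IsHermitian (Cn m) (Cn m) := by
  intro x u v
  let u' : Cn m := u
  let v' : Cn m := v
  change (inner ℝ (Complex.I • u') (Complex.I • v') : ℝ) = inner ℝ u' v'
  have h : ∀ a b : Cn m, (inner ℝ a b : ℝ) = (inner ℂ a b : ℂ).re := fun a b => by
    simp [PiLp.inner_apply]
  rw [h, h, inner_smul_left, inner_smul_right, ← mul_assoc, Complex.conj_I]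
  simp

theorem flatConnection_constField_add {x : Cn m} (v : TangentSpace 𝓘(ℝ, Cn m) x) :
    flatConnection (Cn m) (constField v) x v +
      flatConnection (Cn m) (constField (J (Cn m) x v)) x (J (Cn m) x v) = 0 := by
  rw [flatConnection_constField, flatConnection_constField]
  exact add_zero _

theorem finrank_complexLine {x : Cn m} {v : TangentSpace 𝓘(ℝ, Cn m) x} (hv : ‖v‖ = 1) :
    finrank ℝ (complexLine x v) = 2 := by
  have h := finrank_span_eq_card (isHermitian_Cn.orthonormal hv).linearIndependent
  rw [Matrix.range_cons, Matrix.range_cons, Matrix.range_empty, union_empty] at h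
  exact h

theorem complexLine_le {x : Cn m} {v : TangentSpace 𝓘(ℝ, Cn m) x}
    {T : Submodule ℝ (TangentSpace 𝓘(ℝ, Cn m) x)} :
    complexLine x v ≤ T ↔ v ∈ T ∧ J (Cn m) x v ∈ T := by
  rw [complexLine, Submodule.span_le, insert_subset_iff, singleton_subset_iff]
  rfl

/-- The slice is cut out of `M` by the affine subspace with direction `L + N_x M`, which is
transverse to `M` at `x` and meets `T_x M` in `L`. -/
theorem exists_isEmbeddedSubmanifold_slice {M : Set (Cn m)} {d : ℕ}
    (hM : IsEmbeddedSubmanifold (Cn m) M d) {x : Cn m} (hx : x ∈ M)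
    {L : Submodule ℝ (TangentSpace 𝓘(ℝ, Cn m) x)} (hL : L ≤ tangentSpaceOf (Cn m) M x) :
    ∃ U : Set (Cn m), IsOpen U ∧ x ∈ U ∧
      IsEmbeddedSubmanifold (Cn m) (slice M x L ∩ U) (finrank ℝ L) ∧
      tangentSpaceOf (Cn m) (slice M x L ∩ U) x = L := by
  set T := tangentSpaceOf (Cn m) M x with hT
  have htop : T ⊔ (L ⊔ Tᗮ) = ⊤ := by
    rw [sup_left_comm, Submodule.sup_orthogonal_of_hasOrthogonalProjection, sup_top_eq]
  have hinf : T ⊓ (L ⊔ Tᗮ) = L := by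
    rw [inf_comm, sup_inf_assoc_of_le _ hL, inf_comm, Submodule.inf_orthogonal_eq_bot, sup_bot_eq]
  obtain ⟨U, hU, hxU, h1, h2⟩ := hM.exists_inter_affine hx htop
  rw [← hT, hinf] at h1 h2
  exact ⟨U, hU, hxU, h1, h2⟩

/-- Only the initial velocities of the geodesics matter here, not the geodesic equation. -/
theorem ContainsGeodesics.le_tangentSpaceOf {M S : Set (Cn m)} {x : Cn m}
    {L : Submodule ℝ (TangentSpace 𝓘(ℝ, Cn m) x)} (h : ContainsGeodesics M S x L) :
    L ≤ tangentSpaceOf (Cn m) S x := by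
  intro v hv
  obtain ⟨γ, hγ, rfl, rfl, hS⟩ := h v hv
  exact deriv_mem_tangentSpaceOf (hγ.self_of_nhds.1.differentiableAt (by simp)) hS

theorem leviForm_eq_meanCurvatureVector {M S : Set (Cn m)} {n k : ℕ}
    (hM : IsCRSubmanifold (Cn m) M n k) (hS : IsEmbeddedSubmanifold (Cn m) S 2) (hSM : S ⊆ M)
    {x : Cn m} (hx : x ∈ S) {v : TangentSpace 𝓘(ℝ, Cn m) x} (hv : ‖v‖ = 1)
    (hT : complexLine x v ≤ tangentSpaceOf (Cn m) S x) :
    leviForm (Cn m) M x v = (2 : ℝ) • normalPart (Cn m) M x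
      (meanCurvatureVector (Cn m) (flatConnection (Cn m)) S x) := by
  obtain ⟨h1, h2⟩ := complexLine_le.1 hT
  rw [← normalPart_smul, two_smul_meanCurvatureVector isHermitian_Cn _ hS hx hv h1 h2]
  exact leviForm_eq_normalPart_secondFundamentalForm hM hS hSM hx h1 h2
    (flatConnection_constField_add v)

end Slice


/-! ### Tubes -/

section Tube

variable {m : ℕ}

/-- The real part, as a linear map. -/
def reCLM (m : ℕ) : Cn m →L[ℝ] Rn m :=
  LinearMap.toContinuousLinearMap
    { toFun := rePart
      map_add' := fun z w => by ext; simp [rePart]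
      map_smul' := fun c z => by ext; simp [rePart] }

/-- The inclusion of `ℝ^m` into `ℂ^m`, as a linear map. -/
def ofRealCLM (m : ℕ) : Rn m →L[ℝ] Cn m :=
  LinearMap.toContinuousLinearMap
    { toFun := fun w => WithLp.toLp 2 fun j => ((w j : ℝ) : ℂ)
      map_add' := fun z w => by ext; simp
      map_smul' := fun c z => by ext; simp }

/-- The real part of a tangent vector. -/
def reTangent (z : Cn m) :
    TangentSpace 𝓘(ℝ, Cn m) z →L[ℝ] TangentSpace 𝓘(ℝ, Rn m) (rePart z) :=
  reCLM m

theorem complexify_add (z : Cn m) (u v : TangentSpace 𝓘(ℝ, Rn m) (rePart z)) :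
    complexify z (u + v) = complexify z u + complexify z v :=
  map_add (ofRealCLM m) _ _

theorem complexify_neg (z : Cn m) (u : TangentSpace 𝓘(ℝ, Rn m) (rePart z)) :
    complexify z (-u) = -complexify z u :=
  map_neg (ofRealCLM m) _

theorem complexify_zero (z : Cn m) : complexify z 0 = 0 :=
  map_zero (ofRealCLM m)

theorem reTangent_complexify (z : Cn m) (u : TangentSpace 𝓘(ℝ, Rn m) (rePart z)) :
    reTangent z (complexify z u) = u := by
  refine PiLp.ext fun j => ?_
  exact Complex.ofReal_re _

theorem reTangent_J_complexify (z : Cn m) (u : TangentSpace 𝓘(ℝ, Rn m) (rePart z)) :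
    reTangent z (J (Cn m) z (complexify z u)) = 0 := by
  refine PiLp.ext fun j => ?_
  change (Complex.I * ((_ : ℝ) : ℂ)).re = 0
  simp

theorem reTangent_add (z : Cn m) (u v : TangentSpace 𝓘(ℝ, Rn m) (rePart z)) :
    reTangent z (complexify z u + J (Cn m) z (complexify z v)) = u := by
  rw [map_add, reTangent_complexify, reTangent_J_complexify, add_zero]

theorem J_complexify_add (z : Cn m) (u v : TangentSpace 𝓘(ℝ, Rn m) (rePart z)) :
    J (Cn m) z (complexify z u + J (Cn m) z (complexify z v)) =
      complexify z (-v) + J (Cn m) z (complexify z u) := by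
  rw [map_add, J_J, complexify_neg, add_comm]

/-- A tangent vector is determined by its real part and by that of its multiple by `i`. -/
theorem complexify_reTangent_add (z : Cn m) (w : TangentSpace 𝓘(ℝ, Cn m) z) :
    complexify z (reTangent z w) +
      J (Cn m) z (complexify z (-reTangent z (J (Cn m) z w))) = w := by
  refine PiLp.ext fun j => ?_
  let w' : Cn m := w
  change (((w' j).re : ℝ) : ℂ) + Complex.I * ((-(Complex.I * w' j).re : ℝ) : ℂ) = w' j
  rw [Complex.I_mul_re, neg_neg, mul_comm, Complex.re_add_im]

theorem inner_ofRealCLM (w : Cn m) (u : Rn m) :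
    (inner ℝ w (ofRealCLM m u) : ℝ) = inner ℝ (reCLM m w) u := by
  rw [PiLp.inner_apply, PiLp.inner_apply]
  refine Finset.sum_congr rfl fun j _ => ?_
  change (inner ℝ (w j) ((u j : ℝ) : ℂ) : ℝ) = inner ℝ (w j).re (u j)
  simp [Complex.inner]

theorem mvfderiv_comp_reCLM {F : Type*} [NormedAddCommGroup F] [NormedSpace ℝ F] {ρ : Rn m → F}
    {z : Cn m} (hρ : ContMDiffAt 𝓘(ℝ, Rn m) 𝓘(ℝ, F) ∞ ρ (rePart z))
    (w : TangentSpace 𝓘(ℝ, Cn m) z) :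
    mvfderiv 𝓘(ℝ, Cn m) (ρ ∘ reCLM m) z w =
      mvfderiv 𝓘(ℝ, Rn m) ρ (rePart z) (reTangent z w) := by
  have h1 : DifferentiableAt ℝ ρ (reCLM m z) :=
    ContDiffAt.differentiableAt (contMDiffAt_iff_contDiffAt.1 hρ) (by simp)
  have h := (h1.hasFDerivAt.comp z (reCLM m).hasFDerivAt).fderiv
  rw [mvfderiv_eq_fderiv, mvfderiv_eq_fderiv]
  exact congrArg (fun L : Cn m →L[ℝ] F => L w) h

theorem IsDefiningMap.tube {G U : Set (Rn m)} {F : Type*} [NormedAddCommGroup F] [NormedSpace ℝ F]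
    {ρ : Rn m → F} (h : IsDefiningMap (E := Rn m) G U ρ) :
    IsDefiningMap (E := Cn m) (tube G) (reCLM m ⁻¹' U) (ρ ∘ reCLM m) := by
  refine ⟨h.isOpen.preimage (reCLM m).continuous, ?_, fun z hz => h.mem_iff _ hz, ?_⟩
  · exact h.contMDiffOn.comp (reCLM m).contDiff.contMDiff.contMDiffOn fun z hz => hz
  · intro z hz hzG a
    obtain ⟨v, hv⟩ := h.surjective _ hz hzG a
    refine ⟨complexify z v, ?_⟩
    rw [mvfderiv_comp_reCLM (h.contMDiffAt hz)]
    exact (congrArg (mvfderiv 𝓘(ℝ, Rn m) ρ (rePart z)) (reTangent_complexify z v)).trans hv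

theorem mem_tangentSpaceOf_tube_iff {G : Set (Rn m)} {d : ℕ}
    (hG : IsEmbeddedSubmanifold (Rn m) G d) {z : Cn m} (hz : z ∈ tube G)
    {w : TangentSpace 𝓘(ℝ, Cn m) z} :
    w ∈ tangentSpaceOf (Cn m) (tube G) z ↔
      reTangent z w ∈ tangentSpaceOf (Rn m) G (rePart z) := by
  obtain ⟨l, U, ρ, -, hxU, hρ⟩ := hG.exists_isDefiningMap hz
  rw [hρ.tube.mem_tangentSpaceOf_iff hxU hz, hρ.mem_tangentSpaceOf_iff hxU hz,
    mvfderiv_comp_reCLM (hρ.contMDiffAt hxU)]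

theorem mem_holTangent_tube_iff {G : Set (Rn m)} {d : ℕ}
    (hG : IsEmbeddedSubmanifold (Rn m) G d) {z : Cn m} (hz : z ∈ tube G)
    {w : TangentSpace 𝓘(ℝ, Cn m) z} :
    w ∈ holTangent (Cn m) (tube G) z ↔
      ∃ u ∈ tangentSpaceOf (Rn m) G (rePart z), ∃ v ∈ tangentSpaceOf (Rn m) G (rePart z),
        w = complexify z u + J (Cn m) z (complexify z v) := by
  rw [mem_holTangent_iff, mem_tangentSpaceOf_tube_iff hG hz, mem_tangentSpaceOf_tube_iff hG hz]
  constructor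
  · rintro ⟨h1, h2⟩
    exact ⟨_, h1, _, Submodule.neg_mem _ h2, (complexify_reTangent_add z w).symm⟩
  · rintro ⟨u, hu, v, hv, rfl⟩
    rw [J_complexify_add, reTangent_add, reTangent_add]
    exact ⟨hu, Submodule.neg_mem _ hv⟩

theorem isCRSubmanifold_tube {n k : ℕ} {G : Set (Rn (n + k))}
    (hG : IsEmbeddedSubmanifold (Rn (n + k)) G n) :
    IsCRSubmanifold (Cn (n + k)) (tube G) n k := by
  constructor
  · intro z hz
    obtain ⟨l, U, ρ, hl, hxU, hρ⟩ := hG.exists_isDefiningMap hz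
    refine ⟨l, _, _, ?_, hρ.tube.isOpen, hxU, hρ.tube.contMDiffOn, hρ.tube.mem_iff,
      hρ.tube.surjective⟩
    have h1 : finrank ℝ (Cn (n + k)) = 2 * finrank ℂ (Cn (n + k)) := finrank_real_of_complex _
    rw [finrank_euclideanSpace, Fintype.card_fin] at h1 hl
    omega
  · intro z hz
    let T := tangentSpaceOf (Rn (n + k)) G (rePart z)
    let c₀ : TangentSpace 𝓘(ℝ, Rn (n + k)) (rePart z) →ₗ[ℝ] TangentSpace 𝓘(ℝ, Cn (n + k)) z :=
      (ofRealCLM (n + k)).toLinearMap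
    let c := c₀ ∘ₗ T.subtype
    let f : T × T →ₗ[ℝ] TangentSpace 𝓘(ℝ, Cn (n + k)) z :=
      c.coprod ((J (Cn (n + k)) z).toLinearMap ∘ₗ c)
    have hf : ∀ p : T × T, f p = complexify z p.1 + J (Cn (n + k)) z (complexify z p.2) :=
      fun p => rfl
    have hinj : Function.Injective f := by
      rw [← LinearMap.ker_eq_bot, LinearMap.ker_eq_bot']
      rintro ⟨u, v⟩ h0
      rw [hf] at h0
      have h1 := congrArg (reTangent z) h0
      have h2 := congrArg (fun w => reTangent z (J (Cn (n + k)) z w)) h0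
      simp only [J_complexify_add, reTangent_add, map_zero, neg_eq_zero] at h1 h2
      exact Prod.ext (Subtype.ext h1) (Subtype.ext h2)
    have hrange : holTangent (Cn (n + k)) (tube G) z = f.range := by
      ext w
      refine (mem_holTangent_tube_iff hG hz).trans ⟨?_, ?_⟩
      · rintro ⟨u, hu, v, hv, rfl⟩
        exact ⟨(⟨u, hu⟩, ⟨v, hv⟩), rfl⟩
      · rintro ⟨⟨⟨u, hu⟩, ⟨v, hv⟩⟩, rfl⟩
        exact ⟨u, hu, v, hv, rfl⟩
    have h2 : finrank ℝ T = n := hG.finrank_tangentSpaceOf hz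
    rw [hrange, LinearMap.finrank_range_of_inj hinj, finrank_prod, h2, two_mul]

/-- The tangent space of a tube contains all imaginary vectors, so the normal vectors are real and
they are those of the base. -/
theorem normalPart_tube_complexify {G : Set (Rn m)} {d : ℕ}
    (hG : IsEmbeddedSubmanifold (Rn m) G d) {z : Cn m} (hz : z ∈ tube G)
    (u : TangentSpace 𝓘(ℝ, Rn m) (rePart z)) :
    normalPart (Cn m) (tube G) z (complexify z u) =
      complexify z (normalPart (Rn m) G (rePart z) u) := by
  have hn : complexify z (normalPart (Rn m) G (rePart z) u) ∈
      (tangentSpaceOf (Cn m) (tube G) z)ᗮ := by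
    intro w hw
    refine (inner_ofRealCLM (w : Cn m) (normalPart (Rn m) G (rePart z) u : Rn m)).trans ?_
    exact Submodule.starProjection_apply_mem (tangentSpaceOf (Rn m) G (rePart z))ᗮ u _
      ((mem_tangentSpaceOf_tube_iff hG hz).1 hw)
  have h1 : normalPart (Cn m) (tube G) z (complexify z (normalPart (Rn m) G (rePart z) u)) =
      complexify z (normalPart (Rn m) G (rePart z) u) :=
    Submodule.starProjection_eq_self_iff.2 hn
  rw [← h1]
  refine normalPart_congr ((mem_tangentSpaceOf_tube_iff hG hz).2 ?_)
  have h2 : u - normalPart (Rn m) G (rePart z) u =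
      (tangentSpaceOf (Rn m) G (rePart z)).starProjection u := by
    unfold normalPart
    rw [Submodule.starProjection_orthogonal_val, sub_sub_cancel]
  rw [map_sub, reTangent_complexify, reTangent_complexify, h2]
  exact Submodule.starProjection_apply_mem _ u

/-- The vector field on `ℂ^m` with real part `Y` and constant imaginary part `v`. -/
def tubeField (Y : Π p : Rn m, TangentSpace 𝓘(ℝ, Rn m) p) {p₀ : Rn m}
    (v : TangentSpace 𝓘(ℝ, Rn m) p₀) : Π z : Cn m, TangentSpace 𝓘(ℝ, Cn m) z :=
  fun z => complexify z (Y (rePart z)) + J (Cn m) z (complexify z (v : Rn m))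

theorem IsTangentExtension.tubeField {G : Set (Rn m)} {d : ℕ}
    (hG : IsEmbeddedSubmanifold (Rn m) G d) {z : Cn m} {u : TangentSpace 𝓘(ℝ, Rn m) (rePart z)}
    {Y : Π p : Rn m, TangentSpace 𝓘(ℝ, Rn m) p}
    (hY : IsTangentExtension (Rn m) G (rePart z) u Y) (v : TangentSpace 𝓘(ℝ, Rn m) (rePart z)) :
    IsTangentExtension (Cn m) (tube G) z (complexify z u + J (Cn m) z (complexify z v))
      (tubeField Y v) := by
  have hre : Tendsto (reCLM m) (𝓝 z) (𝓝 (rePart z)) := (reCLM m).continuous.tendsto z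
  refine ⟨smoothNear_iff_contDiffAt.2 ?_, ?_, ?_⟩
  · filter_upwards [hre.eventually (smoothNear_iff_contDiffAt.1 hY.1)] with y hy
    exact ContDiffAt.add ((ofRealCLM m).contDiff.contDiffAt.comp y
      (hy.comp y (reCLM m).contDiff.contDiffAt))
      (contDiffAt_const (c := mulI (Cn m) (ofRealCLM m v)))
  · have hre' : Tendsto (reCLM m) (𝓝[tube G] z) (𝓝[G] (rePart z)) :=
      tendsto_nhdsWithin_iff.2 ⟨hre.mono_left nhdsWithin_le_nhds, self_mem_nhdsWithin⟩
    filter_upwards [hre'.eventually hY.2.1, self_mem_nhdsWithin] with y hy hyG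
    exact (mem_tangentSpaceOf_tube_iff hG hyG).2
      ((reTangent_add y (Y (rePart y)) (v : Rn m)).symm ▸ hy)
  · exact congrArg (fun a => complexify z a + J (Cn m) z (complexify z v)) hY.2.2

theorem flatConnection_tubeField {z : Cn m} {Y : Π p : Rn m, TangentSpace 𝓘(ℝ, Rn m) p}
    (hY : SmoothNear (Rn m) (rePart z) Y) (v : TangentSpace 𝓘(ℝ, Rn m) (rePart z))
    (w : TangentSpace 𝓘(ℝ, Cn m) z) :
    flatConnection (Cn m) (tubeField Y v) z w =
      complexify z (flatConnection (Rn m) Y (rePart z) (reTangent z w)) := by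
  let Y' : Rn m → Rn m := fun p => Y p
  have hYd : DifferentiableAt ℝ Y' (reCLM m z) :=
    (smoothNear_iff_contDiffAt.1 hY).self_of_nhds.differentiableAt (by simp)
  have h : HasFDerivAt (fun y : Cn m => ofRealCLM m (Y' (reCLM m y)) +
      mulI (Cn m) (ofRealCLM m v)) (ofRealCLM m ∘L (fderiv ℝ Y' (reCLM m z) ∘L reCLM m)) z :=
    ((ofRealCLM m).hasFDerivAt.comp z
      (hYd.hasFDerivAt.comp z (reCLM m).hasFDerivAt)).add_const _
  exact congrArg (fun L : Cn m →L[ℝ] Cn m => L w) h.fderiv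

/-- The second fundamental form of a tube, on real vectors, is that of its base. -/
theorem secondFundamentalForm_tube {G : Set (Rn m)} {d e : ℕ}
    (hG : IsEmbeddedSubmanifold (Rn m) G d) (hM : IsEmbeddedSubmanifold (Cn m) (tube G) e)
    {z : Cn m} (hz : z ∈ tube G)
    {v : TangentSpace 𝓘(ℝ, Rn m) (rePart z)} (hv : v ∈ tangentSpaceOf (Rn m) G (rePart z)) :
    secondFundamentalForm (Cn m) (flatConnection (Cn m)) (tube G) z
        (complexify z v) (complexify z v) =
      complexify z (secondFundamentalForm (Rn m) (flatConnection (Rn m)) G (rePart z) v v) := by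
  obtain ⟨Y, hY⟩ := exists_isTangentExtension hG hz hv
  have h1 := hY.tubeField hG 0
  rw [complexify_zero, map_zero, add_zero] at h1
  have h2 : complexify z v ∈ tangentSpaceOf (Cn m) (tube G) z := by
    rwa [mem_tangentSpaceOf_tube_iff hG hz, reTangent_complexify]
  rw [← h1.normalPart_cov _ hM hz h2 h2, flatConnection_tubeField hY.1,
    normalPart_tube_complexify hG hz, ← hY.normalPart_cov _ hG hz hv hv, reTangent_complexify]

/-- The Levi form of a tube. The fields extending `u + iv` and `i (u + iv) = -v + iu` can be chosen
with constant imaginary part, so that only the real parts are differentiated. -/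
theorem leviForm_tube {G : Set (Rn m)} {d : ℕ} (hG : IsEmbeddedSubmanifold (Rn m) G d) {n k : ℕ}
    (hM : IsCRSubmanifold (Cn m) (tube G) n k) {z : Cn m} (hz : z ∈ tube G)
    {u v : TangentSpace 𝓘(ℝ, Rn m) (rePart z)} (hu : u ∈ tangentSpaceOf (Rn m) G (rePart z))
    (hv : v ∈ tangentSpaceOf (Rn m) G (rePart z)) :
    leviForm (Cn m) (tube G) z (complexify z u + J (Cn m) z (complexify z v)) =
      complexify z (secondFundamentalForm (Rn m) (flatConnection (Rn m)) G (rePart z) u u +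
        secondFundamentalForm (Rn m) (flatConnection (Rn m)) G (rePart z) v v) := by
  have hv' := Submodule.neg_mem _ hv
  obtain ⟨Y, hY⟩ := exists_isTangentExtension hG hz hu
  obtain ⟨Z, hZ⟩ := exists_isTangentExtension hG hz hv'
  have hhol := (mem_holTangent_tube_iff hG hz).2 ⟨u, hu, v, hv, rfl⟩
  obtain ⟨h1, h2⟩ := mem_holTangent_iff.1 hhol
  have hY' := hY.tubeField hG v
  have hZ' := hZ.tubeField hG u
  have hneg : secondFundamentalForm (Rn m) (flatConnection (Rn m)) G (rePart z) (-v) (-v) =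
      secondFundamentalForm (Rn m) (flatConnection (Rn m)) G (rePart z) v v := by
    let B := secondFundamentalFormₗ (flatConnection (Rn m)) hG (x := rePart z) hz
    have h3 : B (-⟨v, hv⟩) (-⟨v, hv⟩) = B ⟨v, hv⟩ ⟨v, hv⟩ := by
      rw [B.map_neg₂, map_neg, neg_neg]
    exact h3
  rw [leviForm_eq_chartDeriv hM hz subset_rfl hhol h1 h2 hY'.1 hZ'.1 hY'.2.1 hZ'.2.1 hY'.2.2
    (hZ'.2.2.trans (J_complexify_add z u v).symm), chartDeriv_eq_flatConnection,
    chartDeriv_eq_flatConnection, normalPart_add, flatConnection_tubeField hY.1,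
    flatConnection_tubeField hZ.1, normalPart_tube_complexify hG hz,
    normalPart_tube_complexify hG hz, J_complexify_add, reTangent_add, reTangent_add,
    ← complexify_add, hY.normalPart_cov _ hG hz hu hu, hZ.normalPart_cov _ hG hz hv' hv', hneg]

theorem leviForm_tube_complexify {G : Set (Rn m)} {d : ℕ} (hG : IsEmbeddedSubmanifold (Rn m) G d)
    {n k : ℕ} (hM : IsCRSubmanifold (Cn m) (tube G) n k) {z : Cn m} (hz : z ∈ tube G)
    {v : TangentSpace 𝓘(ℝ, Rn m) (rePart z)} (hv : v ∈ tangentSpaceOf (Rn m) G (rePart z)) :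
    leviForm (Cn m) (tube G) z (complexify z v) =
      complexify z (secondFundamentalForm (Rn m) (flatConnection (Rn m)) G (rePart z) v v) := by
  have h := leviForm_tube hG hM hz hv (Submodule.zero_mem _)
  have h1 : secondFundamentalForm (Rn m) (flatConnection (Rn m)) G (rePart z) 0 0 = 0 := by
    unfold secondFundamentalForm normalPart
    rw [map_zero, map_zero]
  rwa [h1, complexify_zero, map_zero, add_zero, add_zero] at h

end Tube

end CRGeometry

end

theorem mainTheorem2 :
    -- The second fundamental form of a submanifold is well defined.
    (∀ (E : Type*) [NormedAddCommGroup E] [NormedSpace ℝ E] [FiniteDimensional ℝ E]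
      (X : Type*) [TopologicalSpace X] [T2Space X] [ChartedSpace E X] [IsManifold 𝓘(ℝ, E) ∞ X]
      [RiemannianBundle (fun x : X => TangentSpace 𝓘(ℝ, E) x)]
      [IsContMDiffRiemannianBundle 𝓘(ℝ, E) ∞ E (fun x : X => TangentSpace 𝓘(ℝ, E) x)]
      (cov : CovariantDerivative 𝓘(ℝ, E) E (fun x : X => TangentSpace 𝓘(ℝ, E) x))
      (S : Set X) (d : ℕ) (x : X), IsEmbeddedSubmanifold E S d → x ∈ S →
      ∀ u ∈ tangentSpaceOf E S x, ∀ v ∈ tangentSpaceOf E S x,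
        (∃ Y, IsTangentExtension E S x v Y) ∧
        ∀ Y, IsTangentExtension E S x v Y →
          normalPart E S x (cov Y x u) = secondFundamentalForm E cov S x u v) ∧
    -- The normal-valued Levi form is well defined, and it is given by the formula.
    (∀ (E : Type*) [NormedAddCommGroup E] [NormedSpace ℂ E] [FiniteDimensional ℂ E]
      (X : Type*) [TopologicalSpace X] [T2Space X] [ChartedSpace E X] [IsManifold 𝓘(ℂ, E) ω X]
      [RiemannianBundle (fun x : X => TangentSpace 𝓘(ℝ, E) x)]
      [IsContMDiffRiemannianBundle 𝓘(ℝ, E) ∞ E (fun x : X => TangentSpace 𝓘(ℝ, E) x)]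
      (M : Set X) (n k : ℕ) (x : X), IsHermitian E X → IsCRSubmanifold E M n k → x ∈ M →
      ∀ v ∈ holTangent E M x,
        (∃ Y, IsHolTangentExtension E M x v Y) ∧
        (∀ Y, IsHolTangentExtension E M x v Y → leviBracket E M x Y = leviForm E M x v) ∧
        ∀ cov : CovariantDerivative 𝓘(ℝ, E) E (fun x : X => TangentSpace 𝓘(ℝ, E) x),
          IsHermitianConnection E cov ∨ (IsKaehler E X ∧ IsLeviCivita E cov) →
          leviForm E M x v = secondFundamentalForm E cov M x v v +
            secondFundamentalForm E cov M x (J E x v) (J E x v)) ∧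
    -- Mean curvature of two-dimensional slices in complex Euclidean space.
    (∀ (m n k : ℕ) (M : Set (Cn m)) (x : Cn m) (v : TangentSpace 𝓘(ℝ, Cn m) x),
      IsCRSubmanifold (Cn m) M n k → x ∈ M → v ∈ holTangent (Cn m) M x → ‖v‖ = 1 →
      (∃ U : Set (Cn m), IsOpen U ∧ x ∈ U ∧
        IsEmbeddedSubmanifold (Cn m) (slice M x (complexLine x v) ∩ U) 2 ∧
        tangentSpaceOf (Cn m) (slice M x (complexLine x v) ∩ U) x = complexLine x v ∧
        leviForm (Cn m) M x v = (2 : ℝ) • normalPart (Cn m) M x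
          (meanCurvatureVector (Cn m) (flatConnection (Cn m))
            (slice M x (complexLine x v) ∩ U) x)) ∧
      (∀ S : Set (Cn m), IsEmbeddedSubmanifold (Cn m) S 2 → x ∈ S → S ⊆ M →
        (tangentSpaceOf (Cn m) S x = complexLine x v ∨
          ContainsGeodesics M S x (complexLine x v)) →
        tangentSpaceOf (Cn m) S x = complexLine x v ∧
        leviForm (Cn m) M x v = normalPart (Cn m) M x
          (secondFundamentalForm (Cn m) (flatConnection (Cn m)) S x v v +
            secondFundamentalForm (Cn m) (flatConnection (Cn m)) S x
              (J (Cn m) x v) (J (Cn m) x v)) ∧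
        leviForm (Cn m) M x v = (2 : ℝ) • normalPart (Cn m) M x
          (meanCurvatureVector (Cn m) (flatConnection (Cn m)) S x))) ∧
    -- Tube manifolds.
    (∀ (n k : ℕ) (G : Set (Rn (n + k))), IsEmbeddedSubmanifold (Rn (n + k)) G n →
      IsCRSubmanifold (Cn (n + k)) (tube G) n k ∧
      ∀ z ∈ tube G,
        (∀ w, w ∈ holTangent (Cn (n + k)) (tube G) z ↔
          ∃ u ∈ tangentSpaceOf (Rn (n + k)) G (rePart z),
          ∃ v ∈ tangentSpaceOf (Rn (n + k)) G (rePart z),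
            w = complexify z u + J (Cn (n + k)) z (complexify z v)) ∧
        (∀ v ∈ tangentSpaceOf (Rn (n + k)) G (rePart z),
          leviForm (Cn (n + k)) (tube G) z (complexify z v) =
            secondFundamentalForm (Cn (n + k)) (flatConnection (Cn (n + k))) (tube G) z
              (complexify z v) (complexify z v) ∧
          leviForm (Cn (n + k)) (tube G) z (complexify z v) =
            complexify z (secondFundamentalForm (Rn (n + k)) (flatConnection (Rn (n + k)))
              G (rePart z) v v)) ∧
        ∀ u ∈ tangentSpaceOf (Rn (n + k)) G (rePart z),
        ∀ v ∈ tangentSpaceOf (Rn (n + k)) G (rePart z),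
          leviForm (Cn (n + k)) (tube G) z
              (complexify z u + J (Cn (n + k)) z (complexify z v)) =
            complexify z
              (secondFundamentalForm (Rn (n + k)) (flatConnection (Rn (n + k)))
                G (rePart z) u u +
              secondFundamentalForm (Rn (n + k)) (flatConnection (Rn (n + k)))
                G (rePart z) v v)) := by
  refine ⟨?_, ?_, ?_, ?_⟩
  · intro E _ _ _ X _ _ _ _ _ _ cov S d x hS hx u hu v hv
    exact ⟨exists_isTangentExtension hS hx hv, fun Y hY => hY.normalPart_cov cov hS hx hu hv⟩
  · intro E _ _ _ X _ _ _ _ _ _ M n k x _ hM hx v hv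
    refine ⟨exists_isHolTangentExtension hM hx hv,
      fun Y hY => hY.leviBracket_eq_leviForm hM hx hv, fun cov hcov => ?_⟩
    refine leviForm_eq_secondFundamentalForm hM hx hv ?_
    rcases hcov with h | ⟨hK, h⟩
    · exact h.cov_constField_add v
    · exact h.cov_constField_add hK v
  · intro m n k M x v hM hx hv hv1
    have hle : complexLine x v ≤ tangentSpaceOf (Cn m) M x :=
      complexLine_le.2 (mem_holTangent_iff.1 hv)
    constructor
    · obtain ⟨U, hU, hxU, hS, hT⟩ := exists_isEmbeddedSubmanifold_slice hM.submanifold hx hle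
      rw [finrank_complexLine hv1] at hS
      refine ⟨U, hU, hxU, hS, hT, ?_⟩
      have hxS : x ∈ slice M x (complexLine x v) ∩ U := by
        refine ⟨⟨hx, ?_⟩, hxU⟩
        rw [sub_self]
        exact Submodule.zero_mem _
      exact leviForm_eq_meanCurvatureVector hM hS (fun y hy => hy.1.1) hxS hv1 hT.ge
    · intro S hS hxS hSM h
      have hT : complexLine x v ≤ tangentSpaceOf (Cn m) S x :=
        h.elim (fun h => h.ge) fun h => h.le_tangentSpaceOf
      obtain ⟨h1, h2⟩ := complexLine_le.1 hT
      refine ⟨(Submodule.eq_of_le_of_finrank_eq hT ?_).symm, ?_,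
        leviForm_eq_meanCurvatureVector hM hS hSM hxS hv1 hT⟩
      · rw [finrank_complexLine hv1, hS.finrank_tangentSpaceOf hxS]
      · exact leviForm_eq_normalPart_secondFundamentalForm hM hS hSM hxS h1 h2
          (flatConnection_constField_add v)
  · intro n k G hG
    have hM := isCRSubmanifold_tube hG
    refine ⟨hM, fun z hz => ⟨fun w => mem_holTangent_tube_iff hG hz, fun v hv => ?_,
      fun u hu v hv => leviForm_tube hG hM hz hu hv⟩⟩
    have h := leviForm_tube_complexify hG hM hz hv
    exact ⟨h.trans (secondFundamentalForm_tube hG hM.submanifold hz hv).symm, h⟩
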